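/- Let $V\cong\mathbb C^n$ be a finite-dimensional complex vector space, $N\ge 0$ an integer, $P$ the flip on $V\otimes V$, and for operators use leg notation: $Y_i$, $X_{ij}$ act as $Y$, $X$ in the indicated tensor factors, $X_{21}=PX_{12}P$. Write $t$ for the transpose with respect to a fixed basis of $V$, $t_1$ for the partial transpose in the first factor of $V\otimes V$, $\operatorname{Tr}_i$ for the partial trace. "Generic" means outside a closed discrete set of values; for constant operators $X\propto Y$ means $X=mY$ with $m\in\mathbb C^\times$, and for meromorphic operator-valued functions $X(x)\propto Y(x)$ means $X(x)=m(x)Y(x)$ for generic $x$ with $m$ a meromorphic function on $\mathbb C$, not identically zero. Let $R$ be an $\operatorname{End}(V\otimes V)$-valued function and $K^+,K^-$ be $\operatorname{End}(V)$-valued functions, all meromorphic on $\mathbb C$ and generically invertible, such that $R(x)^{t_1}$ is also generically invertible. Put $\tilde R(x)=((R(x)^{t_1})^{-1})^{t_1}$ and $K'(x)_1=\operatorname{Tr}_0 K^+_0(x)P_{01}\tilde R_{01}(x^2)$. Let $M,J\in GL(V)$, $r\in\mathbb C^\times$ and $z=(z_1,\dots,z_N)\in(\mathbb C^\times)^N$.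 Assume: 1. $R$, $K'$, $K^-$ are polynomial in $x$ of degree (at most) $1,2,2$, respectively. 2. (Yang–Baxter) $R_{12}(x/y)R_{13}(x)R_{23}(y)=R_{23}(y)R_{13}(x)R_{12}(x/y)$ for generic $x,y$. 3. (Reflection equations) for generic $x,y$, $R_{12}(x/y)K^+_1(x)R_{21}(xy)K^+_2(y)=K^+_2(y)R_{12}(xy)K^+_1(x)R_{21}(x/y)$ and $R_{21}(x/y)K^-_1(x)R_{12}(xy)K^-_2(y)=K^-_2(y)R_{21}(xy)K^-_1(x)R_{12}(x/y)$. 4. (Crossing symmetry) $M_2^{-1}R_{12}(r^2x)^{-1}M_2\propto\tilde R_{12}(x)$, and $[R(x),M\otimes M]=0$ for generic $x$. 5. (Regularity) $R(1)\propto P$, $K^-(1)\propto\mathrm{Id}_V$ and $K^-(-1)\propto\mathrm{Id}_V$. 6. $R_{12}(x)J_1J_2=J_1J_2R_{21}(x)$ for generic $x$. 7. (Boundary unitarity) $K^\pm(x)K^\pm(x^{-1})\propto\mathrm{Id}_V$ for both signs. 8. $K'(r^{-1})\propto M$ and $K'(-r^{-1})\propto M$. 9. For some ordered basis $(v_\alpha)_{\alpha=1}^n$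 of $V$, with $\bar\alpha=n+1-\alpha$, one has for all $x\in\mathbb C$ and all $\alpha,\beta$: $R(x)(v_\alpha\otimes v_\beta)\in\mathbb Cv_\alpha\otimes v_\beta+\mathbb Cv_\beta\otimes v_\alpha$; $R(0)(v_\alpha\otimes v_\beta)\in\sum_{\gamma\le\alpha,\,\delta\ge\beta}\mathbb Cv_\gamma\otimes v_\delta$; $K^-(x)v_\alpha,\,K'(x)v_\alpha\in\mathbb Cv_\alpha+\mathbb Cv_{\bar\alpha}$; $K^-(0)v_\alpha\in\sum_{\gamma\le\alpha}\mathbb Cv_{\bar\gamma}$; $K'(0)v_{\bar\alpha}\in\sum_{\gamma\le\alpha}\mathbb Cv_\gamma$. Then the inhomogeneous boundary transfer matrix $$\mathcal T(x;z)=\operatorname{Tr}_0 K'_0(x)\,R_{01}\big(\tfrac1{xz_1}\big)^{-1}\cdots R_{0N}\big(\tfrac1{xz_N}\big)^{-1}K^-_0(x)\,R_{0N}\big(\tfrac{x}{z_N}\big)\cdots R_{01}\big(\tfrac{x}{z_1}\big)\in\operatorname{End}(V^{\otimes N})$$ is a meromorphic function of $x\in\mathbb C$, and $[\mathcal T(x;z),\mathcal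 T(y;z)]=0$ for all $x,y$ in its domain (the complement of its poles). -/

import Mathlib

open Matrix Filter Topology
open scoped Kronecker

/-! Throughout, the local space is `V = ℂⁿ`, operators on `V` are `n × n` matrices, operators on
`V ⊗ V` are matrices indexed by `Fin n × Fin n`, and operators on `⨂_{k : I} V` are matrices
indexed by the multi-indices `I → Fin n`.  All matrices act on column vectors. -/

/-- Operators on `V`. -/
abbrev Op1 (n : ℕ) : Type := Matrix (Fin n) (Fin n) ℂ

/-- Operators on `V ⊗ V`. -/
abbrev Op2 (n : ℕ) : Type := Matrix (Fin n × Fin n) (Fin n × Fin n) ℂ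

/-- Operators on the tensor product of copies of `V` labelled by `I`. -/
abbrev OpT (I : Type) (n : ℕ) : Type := Matrix (I → Fin n) (I → Fin n) ℂ

/-! ### Meromorphic operator-valued functions -/

/-- A property holds for generic `x`, i.e. outside a closed discrete subset of `ℂ`. -/
def Generic (p : ℂ → Prop) : Prop := ∀ᶠ x in Filter.codiscrete ℂ, p x

/-- A property holds for generic `x, y`: for generic `x`, it holds for generic `y`.  For identities
between meromorphic functions of `(x, y)` this amounts to equality of the two functions. -/
def Generic₂ (p : ℂ → ℂ → Prop) : Prop := Generic fun x => Generic fun y => p x y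

/-- The matrix-valued function `F` is meromorphic on `ℂ`.  As for Mathlib's `Meromorphic`, values at
isolated points (such as the poles) carry no information. -/
def IsMer {ι : Type} (F : ℂ → Matrix ι ι ℂ) : Prop := ∀ i j, Meromorphic fun x => F x i j

/-- `F` is meromorphic and generically invertible. -/
def IsMerUnit {ι : Type} [Fintype ι] [DecidableEq ι] (F : ℂ → Matrix ι ι ℂ) : Prop :=
  IsMer F ∧ Generic fun x => IsUnit (F x)

/-- The domain of a meromorphic function: the points which are not poles, i.e. where `F` has a
limit. -/
def merDom {ι : Type} (F : ℂ → Matrix ι ι ℂ) : Set ℂ :=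
  {x | ∃ A : Matrix ι ι ℂ, Tendsto F (𝓝[≠] x) (𝓝 A)}

/-- The value of a meromorphic function at a point of its domain. -/
noncomputable def merVal {ι : Type} (F : ℂ → Matrix ι ι ℂ) (x : ℂ) : Matrix ι ι ℂ :=
  limUnder (𝓝[≠] x) F

/-- `F` is polynomial in `x` of degree at most `d`. -/
def IsPolyOfDegree {ι : Type} (d : ℕ) (F : ℂ → Matrix ι ι ℂ) : Prop :=
  ∃ A : ℕ → Matrix ι ι ℂ, ∀ x, F x = ∑ k ∈ Finset.range (d + 1), x ^ k • A k

/-- `X ∝ Y` for constant operators: `X = m Y` with a nonzero scalar `m`. -/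
def Prop1 {ι : Type} (X Y : Matrix ι ι ℂ) : Prop := ∃ m : ℂ, m ≠ 0 ∧ X = m • Y

/-- `X(x) ∝ Y(x)` for operator-valued functions: `X(x) = m(x) Y(x)` for generic `x`, where the scalar
function `m` is meromorphic and not identically zero. -/
def PropMer {ι : Type} (X Y : ℂ → Matrix ι ι ℂ) : Prop :=
  ∃ m : ℂ → ℂ, Meromorphic m ∧ (Generic fun x => m x ≠ 0) ∧ Generic fun x => X x = m x • Y x

/-! ### Tensor legs, partial transposes and partial traces -/

/-- The flip `P (v ⊗ v') = v' ⊗ v` on `V ⊗ V`. -/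
def flipOp (n : ℕ) : Op2 n := fun a b => if a = b.swap then 1 else 0

/-- `X₂₁ = P X P`. -/
def swapLegs {n : ℕ} (X : Op2 n) : Op2 n := flipOp n * X * flipOp n

/-- `Y₁ = Y ⊗ 1` on `V ⊗ V`. -/
def fst {n : ℕ} (Y : Op1 n) : Op2 n := Y ⊗ₖ (1 : Op1 n)

/-- `Y₂ = 1 ⊗ Y` on `V ⊗ V`. -/
def snd {n : ℕ} (Y : Op1 n) : Op2 n := (1 : Op1 n) ⊗ₖ Y

/-- The partial transpose `X ↦ X^{t₁}` with respect to the first factor of `V ⊗ V`. -/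
def ptr1 {n : ℕ} (X : Op2 n) : Op2 n := fun a b => X (b.1, a.2) (a.1, b.2)

/-- The partial trace of an operator on `V ⊗ V` over the first factor. -/
def trFst {n : ℕ} (X : Op2 n) : Op1 n := fun b d => ∑ a, X (a, b) (a, d)

/-- `Yᵢ`: the operator `Y` acting in the `i`-th leg of a tensor product. -/
def leg {I : Type} [Fintype I] [DecidableEq I] {n : ℕ} (i : I) (Y : Op1 n) : OpT I n :=
  fun a b => if ∀ k, k ≠ i → a k = b k then Y (a i) (b i) else 0

/-- `X_{ij}` for `i ≠ j`: the operator `X` acting in the `i`-th and `j`-th legs (in this order). -/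
def legs {I : Type} [Fintype I] [DecidableEq I] {n : ℕ} (i j : I) (X : Op2 n) : OpT I n :=
  fun a b => if ∀ k, k ≠ i → k ≠ j → a k = b k then X (a i, a j) (b i, b j) else 0

/-- The partial trace over the leg labelled `0` of an operator on `V₀ ⊗ V₁ ⊗ ⋯ ⊗ V_N`. -/
def trZero {N n : ℕ} (X : OpT (Fin (N + 1)) n) : OpT (Fin N) n :=
  fun b d => ∑ a : Fin n, X (Fin.cons a b) (Fin.cons a d)

/-- `R̃(x) = ((R(x)^{t₁})⁻¹)^{t₁}`. -/
noncomputable def tildeR {n : ℕ} (R : ℂ → Op2 n) : ℂ → Op2 n := fun x => ptr1 (ptr1 (R x))⁻¹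

/-- `φ_R(Y)₁(x) = Tr₀ Y₀(x) P₀₁ R₀₁(x²)`. -/
def phi {n : ℕ} (R : ℂ → Op2 n) (Y : ℂ → Op1 n) : ℂ → Op1 n :=
  fun x => trFst (fst (Y x) * flipOp n * R (x ^ 2))

/-! ### The local integrability conditions -/

/-- The Yang–Baxter equation (the legs 1, 2, 3 are labelled by `0, 1, 2 : Fin 3`). -/
def YangBaxter {n : ℕ} (R : ℂ → Op2 n) : Prop :=
  Generic₂ fun x y =>
    (legs 0 1 (R (x / y)) * legs 0 2 (R x) * legs 1 2 (R y) : OpT (Fin 3) n) =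
      legs 1 2 (R y) * legs 0 2 (R x) * legs 0 1 (R (x / y))

/-- The left reflection equation. -/
def LeftReflection {n : ℕ} (R : ℂ → Op2 n) (K : ℂ → Op1 n) : Prop :=
  Generic₂ fun x y =>
    R (x / y) * fst (K x) * swapLegs (R (x * y)) * snd (K y) =
      snd (K y) * R (x * y) * fst (K x) * swapLegs (R (x / y))

/-- The right reflection equation. -/
def RightReflection {n : ℕ} (R : ℂ → Op2 n) (K : ℂ → Op1 n) : Prop :=
  Generic₂ fun x y =>
    swapLegs (R (x / y)) * fst (K x) * R (x * y) * snd (K y) =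
      snd (K y) * swapLegs (R (x * y)) * fst (K x) * R (x / y)

/-- Crossing symmetry: `M₂⁻¹ R(r²x)⁻¹ M₂ ∝ R̃(x)` and `[R(x), M ⊗ M] = 0`. -/
def CrossingSymmetry {n : ℕ} (R : ℂ → Op2 n) (M : Op1 n) (r : ℂ) : Prop :=
  PropMer (fun x => (snd M)⁻¹ * (R (r ^ 2 * x))⁻¹ * snd M) (tildeR R) ∧
    Generic fun x => R x * (M ⊗ₖ M) = (M ⊗ₖ M) * R x

/-- Boundary unitarity: `K(x) K(x⁻¹) ∝ 1`. -/
def BoundaryUnitary {n : ℕ} (K : ℂ → Op1 n) : Prop :=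
  PropMer (fun x => K x * K x⁻¹) (fun _ => 1)

/-! ### Conditions with respect to an ordered basis -/

/-- The pure tensor `u ⊗ w` in `V ⊗ V`. -/
def pureTensor {n : ℕ} (u w : Fin n → ℂ) : Fin n × Fin n → ℂ := fun p => u p.1 * w p.2

/-- `R(x)(v_α ⊗ v_β) ∈ ℂ v_α ⊗ v_β + ℂ v_β ⊗ v_α`. -/
def RImageCondition {n : ℕ} (v : Fin n → Fin n → ℂ) (R : ℂ → Op2 n) : Prop :=
  ∀ x α β, R x *ᵥ pureTensor (v α) (v β) ∈
    Submodule.span ℂ {pureTensor (v α) (v β), pureTensor (v β) (v α)}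

/-- `R(0)(v_α ⊗ v_β)` lies in the span of the `v_γ ⊗ v_δ` with `γ ≤ α` and `δ ≥ β`. -/
def RZeroCondition {n : ℕ} (v : Fin n → Fin n → ℂ) (R : ℂ → Op2 n) : Prop :=
  ∀ α β, R 0 *ᵥ pureTensor (v α) (v β) ∈
    Submodule.span ℂ {t | ∃ γ δ, γ ≤ α ∧ β ≤ δ ∧ t = pureTensor (v γ) (v δ)}

/-- `K(x) v_α ∈ ℂ v_α + ℂ v_ᾱ`, where `ᾱ = n + 1 - α` is the reversed index. -/
def KImageCondition {n : ℕ} (v : Fin n → Fin n → ℂ) (K : ℂ → Op1 n) : Prop :=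
  ∀ x α, K x *ᵥ v α ∈ Submodule.span ℂ {v α, v (Fin.rev α)}

/-- `K⁻(0) v_α` lies in the span of the `v_γ̄` with `γ ≤ α`, and `K'(0) v_ᾱ` in the span of the `v_γ`
with `γ ≤ α`. -/
def KZeroCondition {n : ℕ} (v : Fin n → Fin n → ℂ) (K' Km : ℂ → Op1 n) : Prop :=
  ∀ α, Km 0 *ᵥ v α ∈ Submodule.span ℂ {t | ∃ γ, γ ≤ α ∧ t = v (Fin.rev γ)} ∧
    K' 0 *ᵥ v (Fin.rev α) ∈ Submodule.span ℂ {t | ∃ γ, γ ≤ α ∧ t = v γ}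

/-! ### The inhomogeneous boundary transfer matrix -/

/-- `R₀₁(1/(x z₁))⁻¹ ⋯ R₀N(1/(x z_N))⁻¹`. -/
noncomputable def invRow {N n : ℕ} (R : ℂ → Op2 n) (z : Fin N → ℂ) (x : ℂ) : OpT (Fin (N + 1)) n :=
  (List.ofFn fun i : Fin N => legs 0 i.succ (R (1 / (x * z i)))⁻¹).prod

/-- `R₀N(x/z_N) ⋯ R₀₁(x/z₁)`. -/
noncomputable def row {N n : ℕ} (R : ℂ → Op2 n) (z : Fin N → ℂ) (x : ℂ) : OpT (Fin (N + 1)) n :=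
  (List.ofFn fun i : Fin N => legs 0 i.succ (R (x / z i))).reverse.prod

/-- `𝒯(x; z) = Tr₀ K'₀(x) R₀₁(1/(x z₁))⁻¹ ⋯ R₀N(1/(x z_N))⁻¹ K⁻₀(x) R₀N(x/z_N) ⋯ R₀₁(x/z₁)`, as an
operator on `V^{⊗N}`. -/
noncomputable def boundaryTransfer {N n : ℕ} (R : ℂ → Op2 n) (K' Km : ℂ → Op1 n) (z : Fin N → ℂ) :
    ℂ → OpT (Fin N) n :=
  fun x => trZero (leg 0 (K' x) * invRow R z x * leg 0 (Km x) * row R z x)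

/-! This is Sklyanin's argument. The transfer matrix at x is the trace over an auxiliary copy of V
of K'(x) U(x), where U (`doubleRow`) is K⁻(x) dressed by the monodromy matrix T(x) on the right and
by T(1/x)⁻¹ on the left. By the Yang–Baxter equation T satisfies an exchange relation with R
(`exchange_monodromy`), so U solves the same reflection equation as K⁻, now with operators as
entries (`reflection_doubleRow`).

The other boundary matrix solves the dual equation R₁₂(x/y) K'₂(y) R̃₁₂(xy) K'₁(x) = K'₁(x) R̃₂₁(xy)
K'₂(y) R₂₁(x/y) (`dual_reflection`). Indeed K⁺(x) = Tr₀ K'₀(x) P₀₁ R₀₁(x²). After substituting this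
into the reflection equation for K⁺, Yang–Baxter moves turn each side into the trace of the
corresponding side of the dual equation against one and the same kernel. The kernel is
nondegenerate, because up to flips and partial transposition it is a product of invertible
operators.

A product of two transfer matrices becomes a single trace over two auxiliary spaces once R̃(xy) and
R(xy) are inserted, which is allowed because their partial transposes are inverse to each other. The
reflection equation and its dual then reverse the order of the factors, and R(x/y) cancels by
cyclicity (`trace_commute_of_reflection`).

This works wherever the operators involved are invertible (`boundaryTransfer_commute`), which is
generic by polynomiality; two successive limits reach the whole domain (`merVal_commute`). -/

/-! ### Matrices over an algebra, as operators on an auxiliary space -/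

section Auxiliary

set_option linter.unusedSectionVars false

variable {A : Type} [Ring A] [Algebra ℂ A] {n : ℕ} {κ : Type} [Fintype κ] [DecidableEq κ]

/-- Complex matrices as matrices over a `ℂ`-algebra. -/
def auxScalar (A : Type) [Ring A] [Algebra ℂ A] {κ : Type} [Fintype κ] [DecidableEq κ] :
    Matrix κ κ ℂ →+* Matrix κ κ A :=
  (algebraMap ℂ A).mapMatrix

/-- `U₁` on two auxiliary spaces, for `U` with noncommuting entries. -/
def auxFst (U : Matrix (Fin n) (Fin n) A) : Matrix (Fin n × Fin n) (Fin n × Fin n) A :=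
  of fun p q => if p.2 = q.2 then U p.1 q.1 else 0

/-- `U₂` on two auxiliary spaces, for `U` with noncommuting entries. -/
def auxSnd (U : Matrix (Fin n) (Fin n) A) : Matrix (Fin n × Fin n) (Fin n × Fin n) A :=
  of fun p q => if p.1 = q.1 then U p.2 q.2 else 0

@[simp] lemma auxScalar_apply (X : Matrix κ κ ℂ) (i j : κ) :
    auxScalar A X i j = algebraMap ℂ A (X i j) := rfl

lemma auxFst_mul (U W : Matrix (Fin n) (Fin n) A) : auxFst (U * W) = auxFst U * auxFst W := by
  ext ⟨a, b⟩ ⟨c, d⟩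
  by_cases h : b = d <;> simp [auxFst, mul_apply, Fintype.sum_prod_type, h]

lemma auxSnd_mul (U W : Matrix (Fin n) (Fin n) A) : auxSnd (U * W) = auxSnd U * auxSnd W := by
  ext ⟨a, b⟩ ⟨c, d⟩
  by_cases h : a = c <;> simp [auxSnd, mul_apply, Fintype.sum_prod_type, h]

lemma auxFst_one : auxFst (1 : Matrix (Fin n) (Fin n) A) = 1 := by
  ext ⟨a, b⟩ ⟨c, d⟩
  simp only [auxFst, of_apply, one_apply, Prod.mk.injEq]
  split_ifs <;> tauto

lemma auxSnd_one : auxSnd (1 : Matrix (Fin n) (Fin n) A) = 1 := by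
  ext ⟨a, b⟩ ⟨c, d⟩
  simp only [auxSnd, of_apply, one_apply, Prod.mk.injEq]
  split_ifs <;> tauto

/-- The order of the entries follows the order of the factors, so operators on different auxiliary
spaces commute only if their entries do. -/
lemma auxFst_mul_auxSnd_apply (U W : Matrix (Fin n) (Fin n) A) (a b c d : Fin n) :
    (auxFst U * auxSnd W) (a, b) (c, d) = U a c * W b d := by
  simp [auxFst, auxSnd, mul_apply, Fintype.sum_prod_type]

lemma auxSnd_mul_auxFst_apply (U W : Matrix (Fin n) (Fin n) A) (a b c d : Fin n) :
    (auxSnd W * auxFst U) (a, b) (c, d) = W b d * U a c := by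
  simp [auxFst, auxSnd, mul_apply, Fintype.sum_prod_type]

lemma commute_auxFst_auxSnd {U W : Matrix (Fin n) (Fin n) A}
    (h : ∀ a b c d, Commute (U a b) (W c d)) : Commute (auxFst U) (auxSnd W) := by
  ext ⟨a, b⟩ ⟨c, d⟩
  rw [auxFst_mul_auxSnd_apply, auxSnd_mul_auxFst_apply]
  exact h ..

lemma commute_auxFst_auxSnd_auxScalar (U : Matrix (Fin n) (Fin n) A) (K : Op1 n) :
    Commute (auxFst U) (auxSnd (auxScalar A K)) :=
  commute_auxFst_auxSnd fun _ _ _ _ => (Algebra.commutes _ _).symm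

lemma commute_auxFst_auxScalar_auxSnd (K : Op1 n) (W : Matrix (Fin n) (Fin n) A) :
    Commute (auxFst (auxScalar A K)) (auxSnd W) :=
  commute_auxFst_auxSnd fun _ _ _ _ => Algebra.commutes _ _

lemma auxFst_auxScalar (K : Op1 n) : auxFst (auxScalar A K) = auxScalar A (fst K) := by
  ext ⟨a, b⟩ ⟨c, d⟩
  by_cases h : b = d <;> simp [auxFst, fst, one_apply, h]

lemma auxSnd_auxScalar (K : Op1 n) : auxSnd (auxScalar A K) = auxScalar A (snd K) := by
  ext ⟨a, b⟩ ⟨c, d⟩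
  by_cases h : a = c <;> simp [auxSnd, snd, one_apply, h]

/-! ### The flip of the two auxiliary spaces. -/

lemma flipOp_apply (a b : Fin n × Fin n) : flipOp n a b = if a = b.swap then 1 else 0 := rfl

lemma flipOp_mul_apply (X : Matrix (Fin n × Fin n) (Fin n × Fin n) A) (p q) :
    (auxScalar A (flipOp n) * X) p q = X p.swap q := by
  have h : ∀ x : Fin n × Fin n, p = x.swap ↔ p.swap = x := by
    rintro ⟨a, b⟩; obtain ⟨c, d⟩ := p; simp [and_comm]
  simp [mul_apply, flipOp_apply, h, apply_ite (algebraMap ℂ A)]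

lemma mul_flipOp_apply (X : Matrix (Fin n × Fin n) (Fin n × Fin n) A) (p q) :
    (X * auxScalar A (flipOp n)) p q = X p q.swap := by
  simp [mul_apply, flipOp_apply, apply_ite (algebraMap ℂ A)]

lemma auxScalar_flipOp_mul_auxFst (U : Matrix (Fin n) (Fin n) A) :
    auxScalar A (flipOp n) * auxFst U = auxSnd U * auxScalar A (flipOp n) := by
  ext ⟨a, b⟩ ⟨c, d⟩
  rw [flipOp_mul_apply, mul_flipOp_apply]; rfl

lemma auxScalar_flipOp_mul_auxSnd (U : Matrix (Fin n) (Fin n) A) :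
    auxScalar A (flipOp n) * auxSnd U = auxFst U * auxScalar A (flipOp n) := by
  ext ⟨a, b⟩ ⟨c, d⟩
  rw [flipOp_mul_apply, mul_flipOp_apply]; rfl

lemma auxScalar_id (X : Matrix κ κ ℂ) : auxScalar ℂ X = X := rfl

lemma flipOp_mul_flipOp : flipOp n * flipOp n = 1 := by
  ext p q
  have := flipOp_mul_apply (A := ℂ) (flipOp n) p q
  rw [auxScalar_id] at this
  rw [this, flipOp_apply, one_apply]
  simp [Prod.swap_inj]

lemma swapLegs_apply (X : Op2 n) (p q) : swapLegs X p q = X p.swap q.swap := by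
  have h1 := mul_flipOp_apply (A := ℂ) (flipOp n * X) p q
  have h2 := flipOp_mul_apply (A := ℂ) X p q.swap
  rw [auxScalar_id] at h1 h2
  rw [swapLegs, h1, h2]

lemma swapLegs_mul (X Y : Op2 n) : swapLegs (X * Y) = swapLegs X * swapLegs Y := by
  simp only [swapLegs]
  rw [show flipOp n * X * flipOp n * (flipOp n * Y * flipOp n) =
    flipOp n * X * (flipOp n * flipOp n) * Y * flipOp n by noncomm_ring, flipOp_mul_flipOp]
  noncomm_ring

lemma swapLegs_one : swapLegs (1 : Op2 n) = 1 := by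
  rw [swapLegs, mul_one, flipOp_mul_flipOp]

lemma IsUnit.swapLegs {X : Op2 n} (h : IsUnit X) : IsUnit (swapLegs X) :=
  h.map ({ toFun := _root_.swapLegs, map_one' := swapLegs_one, map_mul' := swapLegs_mul } :
    Op2 n →* Op2 n)

/-- The exchange relation for the other order of the auxiliary spaces. -/
lemma exchange_swap {X Y : Op2 n} {U W U' W' : Matrix (Fin n) (Fin n) A}
    (h : auxScalar A X * auxFst U * auxSnd W = auxSnd W' * auxFst U' * auxScalar A Y) :
    auxScalar A (swapLegs X) * auxSnd U * auxFst W =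
      auxFst W' * auxSnd U' * auxScalar A (swapLegs Y) := by
  set P := auxScalar A (flipOp n)
  have hP : P * P = 1 := by rw [← map_mul, flipOp_mul_flipOp, map_one]
  have e1 : auxSnd U = P * auxFst U * P := by
    rw [auxScalar_flipOp_mul_auxFst, mul_assoc, hP, mul_one]
  have e2 : auxFst W = P * auxSnd W * P := by
    rw [auxScalar_flipOp_mul_auxSnd, mul_assoc, hP, mul_one]
  have e3 : auxFst W' = P * auxSnd W' * P := by
    rw [auxScalar_flipOp_mul_auxSnd, mul_assoc, hP, mul_one]
  have e4 : auxSnd U' = P * auxFst U' * P := by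
    rw [auxScalar_flipOp_mul_auxFst, mul_assoc, hP, mul_one]
  simp only [swapLegs, map_mul, e1, e2, e3, e4]
  calc P * auxScalar A X * P * (P * auxFst U * P) * (P * auxSnd W * P)
      = P * (auxScalar A X * (P * P) * auxFst U * (P * P) * auxSnd W) * P := by noncomm_ring
    _ = P * (auxSnd W' * (P * P) * auxFst U' * (P * P) * auxScalar A Y) * P := by
        simp only [hP, mul_one, h]
    _ = _ := by noncomm_ring

/-! ### Traces of matrices with operator entries. -/

/-- Cyclicity of the trace fails for noncommuting entries; it survives when one factor has complex,
hence central, entries. All later trace manipulations rest on this case. -/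
lemma trace_auxScalar_mul_comm (X : Matrix κ κ ℂ) (Y : Matrix κ κ A) :
    trace (auxScalar A X * Y) = trace (Y * auxScalar A X) := by
  simp only [trace, diag_apply, mul_apply, auxScalar_apply]
  rw [Finset.sum_comm]
  simp only [Algebra.commutes]

/-- If the partial transposes of `X` and `Y` are inverse to each other, then `X` and `Y` may be
inserted into a product of two traces. -/
lemma trace_insert {X Y : Op2 n} (h : ptr1 X * ptr1 Y = 1) (U W : Matrix (Fin n) (Fin n) A) :
    trace (auxScalar A X * auxFst U * auxScalar A Y * auxSnd W) = trace U * trace W := by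
  -- Contracting these two indices of `X` and `Y` is exactly an entry of `ptr1 X * ptr1 Y`.
  have hXY : ∀ a' c b d, ∑ p : Fin n × Fin n, X (p.1, b) (a', p.2) * Y (c, p.2) (p.1, d) =
      if a' = c ∧ b = d then 1 else 0 := by
    intro a' c b d
    have := congrFun (congrFun h (a', b)) (c, d)
    rw [mul_apply, one_apply] at this
    simp only [Prod.mk.injEq] at this
    exact this
  have e1 : ∀ p q, (auxScalar A X * auxFst U) p q =
      ∑ a', algebraMap ℂ A (X p (a', q.2)) * U a' q.1 := by
    intro p q
    simp [mul_apply, auxFst, Fintype.sum_prod_type]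
  have e2 : ∀ p q, (auxScalar A Y * auxSnd W) p q =
      ∑ d, algebraMap ℂ A (Y p (q.1, d)) * W d q.2 := by
    intro p q
    rw [mul_apply, Fintype.sum_prod_type, Finset.sum_comm]
    simp [auxSnd]
  rw [mul_assoc]
  simp only [trace, diag_apply]
  simp_rw [mul_apply (M := auxScalar A X * auxFst U), e1, e2, Finset.sum_mul_sum]
  -- Complex coefficients can be collected in front, while the order of the entries of `U` and `W`
  -- has to be kept.
  have e3 : ∀ (p q : Fin n × Fin n) (a' d : Fin n),
      algebraMap ℂ A (X p (a', q.2)) * U a' q.1 * (algebraMap ℂ A (Y q (p.1, d)) * W d p.2) =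
      algebraMap ℂ A (X p (a', q.2) * Y q (p.1, d)) * (U a' q.1 * W d p.2) := by
    intro p q a' d
    rw [map_mul, mul_assoc, ← mul_assoc (U a' q.1), ← Algebra.commutes _ (U a' q.1)]
    noncomm_ring
  simp_rw [e3]
  calc _ = ∑ b, ∑ c, ∑ a', ∑ d, ∑ p : Fin n × Fin n,
        algebraMap ℂ A (X (p.1, b) (a', p.2) * Y (c, p.2) (p.1, d)) * (U a' c * W d b) := by
        simp only [Fintype.sum_prod_type]
        rw [Finset.sum_comm]
        refine Finset.sum_congr rfl fun b _ => ?_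
        rw [Finset.sum_comm]
        refine Finset.sum_congr rfl fun c _ => ?_
        rw [Finset.sum_congr rfl fun a _ => Finset.sum_comm]
        rw [Finset.sum_comm]
        refine Finset.sum_congr rfl fun a' _ => ?_
        rw [Finset.sum_congr rfl fun a _ => Finset.sum_comm]
        rw [Finset.sum_comm]
    _ = _ := by
        simp_rw [← Finset.sum_mul, ← map_sum, hXY]
        simp only [apply_ite (algebraMap ℂ A), map_one, map_zero, ite_mul, one_mul, zero_mul,
          ite_and]
        rw [Finset.sum_comm]
        simp

/-- Conjugation of `trace_insert` by the flip. It serves the product of traces in the opposite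
order, where the first factor lives on the second auxiliary space. -/
lemma trace_insert_swap {X Y : Op2 n} (h : ptr1 X * ptr1 Y = 1)
    (U W : Matrix (Fin n) (Fin n) A) :
    trace (auxScalar A (swapLegs X) * auxSnd U * auxScalar A (swapLegs Y) * auxFst W) =
      trace U * trace W := by
  rw [← trace_insert h]
  set P := auxScalar A (flipOp n)
  have hP : P * P = 1 := by rw [← map_mul, flipOp_mul_flipOp, map_one]
  have e1 : auxSnd U = P * auxFst U * P := by
    rw [auxScalar_flipOp_mul_auxFst, mul_assoc, hP, mul_one]
  have e2 : auxFst W = P * auxSnd W * P := by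
    rw [auxScalar_flipOp_mul_auxSnd, mul_assoc, hP, mul_one]
  simp only [swapLegs, map_mul, e1, e2]
  rw [show P * auxScalar A X * P * (P * auxFst U * P) * (P * auxScalar A Y * P) *
      (P * auxSnd W * P) = P * (auxScalar A X * (P * P) * auxFst U * (P * P) * auxScalar A Y *
      (P * P) * auxSnd W * P) by noncomm_ring, trace_auxScalar_mul_comm]
  change trace (_ * P) = _
  simp only [hP, mul_one, mul_assoc]

/-- The traces of two solutions of the reflection equation commute, when weighted with solutions of
the dual reflection equation. -/
theorem trace_commute_of_reflection {X₁ X₂ Y Yt : Op2 n} {K L : Op1 n}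
    {U W : Matrix (Fin n) (Fin n) A} (hY : ptr1 Yt * ptr1 Y = 1) (hX : IsUnit X₂)
    (hdual : X₁ * snd L * Yt * fst K = fst K * swapLegs Yt * snd L * X₂)
    (href : auxScalar A X₂ * auxFst U * auxScalar A Y * auxSnd W =
      auxSnd W * auxScalar A (swapLegs Y) * auxFst U * auxScalar A X₁) :
    Commute (trace (auxScalar A K * U)) (trace (auxScalar A L * W)) := by
  obtain ⟨u, rfl⟩ := hX
  set Xi : Op2 n := ((u⁻¹ : (Op2 n)ˣ) : Op2 n)
  have h1 : trace (auxScalar A K * U) * trace (auxScalar A L * W) =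
      trace (auxScalar A (snd L * Yt * fst K) * (auxFst U * auxScalar A Y * auxSnd W)) := by
    rw [trace_auxScalar_mul_comm L, ← trace_insert hY, auxFst_mul, auxSnd_mul,
      auxFst_auxScalar, auxSnd_auxScalar, ← mul_assoc, ← trace_auxScalar_mul_comm]
    simp only [map_mul, mul_assoc]
  have h2 : trace (auxScalar A L * W) * trace (auxScalar A K * U) =
      trace (auxScalar A (fst K * swapLegs Yt * snd L) *
        (auxSnd W * auxScalar A (swapLegs Y) * auxFst U)) := by
    rw [trace_auxScalar_mul_comm K, ← trace_insert_swap hY, auxFst_mul, auxSnd_mul,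
      auxFst_auxScalar, auxSnd_auxScalar, ← mul_assoc, ← trace_auxScalar_mul_comm]
    simp only [map_mul, mul_assoc]
  rw [Commute, SemiconjBy, h1, h2]
  have hu : (u : Op2 n) * Xi = 1 := u.mul_inv
  have hu' : Xi * (u : Op2 n) = 1 := u.inv_mul
  -- Inserting `Xi * u = 1` creates the factor that `href` needs. The matrix `X₁` it releases on the
  -- right is complex, so it cycles to the front, where `hdual` applies and leaves `u * Xi = 1`.
  calc _ = trace (auxScalar A (snd L * Yt * fst K * Xi) *
        (auxScalar A (u : Op2 n) * auxFst U * auxScalar A Y * auxSnd W)) := by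
        rw [show auxScalar A (snd L * Yt * fst K * Xi) *
          (auxScalar A (u : Op2 n) * auxFst U * auxScalar A Y * auxSnd W) =
          auxScalar A (snd L * Yt * fst K) * (auxScalar A Xi * auxScalar A (u : Op2 n)) *
          (auxFst U * auxScalar A Y * auxSnd W) by
            rw [map_mul _ _ Xi]; noncomm_ring, ← map_mul _ Xi, hu', map_one, mul_one]
    _ = trace (auxScalar A (X₁ * snd L * Yt * fst K * Xi) *
        (auxSnd W * auxScalar A (swapLegs Y) * auxFst U)) := by
        rw [href, ← mul_assoc, ← trace_auxScalar_mul_comm, ← mul_assoc, ← map_mul]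
        simp only [mul_assoc]
    _ = _ := by rw [hdual, mul_assoc _ (u : Op2 n), hu, mul_one]

end Auxiliary

/-! ### Operators acting in some of the legs of a tensor product -/

section Legs

set_option linter.unusedSectionVars false

variable {I J : Type} [Fintype I] [DecidableEq I] [Fintype J] [DecidableEq J] {n : ℕ}

/-- The operator `X` on the legs `J`, acting in the legs `f j` of a tensor product. -/
def embedLegs (f : J → I) (X : OpT J n) : OpT I n :=
  fun a b => if ∀ k, (∀ j, f j ≠ k) → a k = b k then X (a ∘ f) (b ∘ f) else 0

/-- Only intermediate multi-indices agreeing with `a` off the range of `f` contribute;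
`Function.extend` parametrizes them by multi-indices on `J`. -/
lemma embedLegs_mul_apply {f : J → I} (hf : f.Injective) (X : OpT J n) (Y : OpT I n) (a b) :
    (embedLegs f X * Y) a b = ∑ c, X (a ∘ f) c * Y (Function.extend f c a) b := by
  simp only [mul_apply, embedLegs, ite_mul, zero_mul]
  rw [← Finset.sum_filter]
  refine Finset.sum_nbij' (fun d => d ∘ f) (fun c => Function.extend f c a) (by simp) ?_ ?_ ?_ ?_
  · intro c _
    simp only [Finset.mem_filter, Finset.mem_univ, true_and]
    intro k hk
    rw [Function.extend_apply' _ _ _ (by simpa using hk)]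
  · intro d hd
    simp only [Finset.mem_filter, Finset.mem_univ, true_and] at hd
    ext k : 1
    by_cases hk : ∃ j, f j = k
    · obtain ⟨j, rfl⟩ := hk
      rw [hf.extend_apply]; rfl
    · rw [Function.extend_apply' _ _ _ hk, hd k (by simpa using hk)]
  · intro c _
    exact Function.extend_comp hf _ _
  · intro d hd
    simp only [Finset.mem_filter, Finset.mem_univ, true_and] at hd
    congr 2
    ext k : 1
    by_cases hk : ∃ j, f j = k
    · obtain ⟨j, rfl⟩ := hk
      rw [hf.extend_apply]; rfl
    · rw [Function.extend_apply' _ _ _ hk, hd k (by simpa using hk)]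

lemma embedLegs_mul {f : J → I} (hf : f.Injective) (X Y : OpT J n) :
    embedLegs f (X * Y) = embedLegs f X * embedLegs f Y := by
  ext a b
  rw [embedLegs_mul_apply hf]
  have h : ∀ c, embedLegs f Y (Function.extend f c a) b =
      if ∀ k, (∀ j, f j ≠ k) → a k = b k then Y c (b ∘ f) else 0 := by
    intro c
    have : (∀ k, (∀ j, f j ≠ k) → Function.extend f c a k = b k) ↔
        ∀ k, (∀ j, f j ≠ k) → a k = b k :=
      forall_congr' fun k => forall_congr' fun hk => by
        rw [Function.extend_apply' _ _ _ (by simpa using hk)]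
    simp only [embedLegs, this, Function.extend_comp hf]
  simp only [h]
  simp only [embedLegs, mul_apply]
  split_ifs <;> simp

lemma embedLegs_one {f : J → I} : embedLegs f (1 : OpT J n) = 1 := by
  ext a b
  simp only [embedLegs, one_apply]
  by_cases hab : a = b
  · simp [hab]
  · simp only [hab, if_false, ite_eq_right_iff]
    intro h h'
    refine absurd (funext fun k => ?_) hab
    by_cases hk : ∃ j, f j = k
    · obtain ⟨j, rfl⟩ := hk
      exact congrFun h' j
    · exact h k (by simpa using hk)

/-- The formula is symmetric in the two operators, so commutation of operators on disjoint legs can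
be read off. -/
lemma embedLegs_mul_disjoint {K : Type} [Fintype K] [DecidableEq K] {f : J → I} {g : K → I}
    (hf : f.Injective) (hfg : ∀ j k, f j ≠ g k) (X : OpT J n) (Y : OpT K n) (a b) :
    (embedLegs f X * embedLegs g Y) a b =
      if ∀ k, (∀ j, f j ≠ k) → (∀ j, g j ≠ k) → a k = b k then
        X (a ∘ f) (b ∘ f) * Y (a ∘ g) (b ∘ g) else 0 := by
  rw [embedLegs_mul_apply hf, Finset.sum_eq_single (b ∘ f)]
  · have h1 : Function.extend f (b ∘ f) a ∘ g = a ∘ g := by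
      ext k : 1
      exact Function.extend_apply' _ _ _ (by simpa using fun j => hfg j k)
    have h2 : (∀ k, (∀ j, g j ≠ k) → Function.extend f (b ∘ f) a k = b k) ↔
        ∀ k, (∀ j, f j ≠ k) → (∀ j, g j ≠ k) → a k = b k := by
      refine forall_congr' fun k => ?_
      by_cases hk : ∃ j, f j = k
      · obtain ⟨j, rfl⟩ := hk
        simp [hf.extend_apply]
      · rw [Function.extend_apply' _ _ _ hk]
        have : ∀ j, f j ≠ k := by simpa using hk
        simp [this]
    simp only [embedLegs, h1, h2, mul_ite, mul_zero]
  · intro c _ hc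
    rw [embedLegs, if_neg, mul_zero]
    contrapose! hc
    ext j : 1
    rw [← hf.extend_apply c a j]
    exact hc _ fun k => (hfg j k).symm
  · simp

lemma commute_embedLegs {K : Type} [Fintype K] [DecidableEq K] {f : J → I} {g : K → I}
    (hf : f.Injective) (hg : g.Injective) (hfg : ∀ j k, f j ≠ g k) (X : OpT J n) (Y : OpT K n) :
    Commute (embedLegs f X) (embedLegs g Y) := by
  ext a b
  rw [embedLegs_mul_disjoint hf hfg, embedLegs_mul_disjoint hg fun j k => (hfg k j).symm]
  refine if_congr (forall_congr' fun k => ?_) (mul_comm _ _) rfl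
  tauto

lemma embedLegs_legs {f : J → I} (hf : f.Injective) (i j : J) (X : Op2 n) :
    embedLegs f (legs i j X) = legs (f i) (f j) X := by
  ext a b
  simp only [embedLegs, legs, Function.comp_apply, ← ite_and]
  refine if_congr ⟨fun h k hi hj => ?_, fun h => ⟨fun k hk => h k (hk i).symm (hk j).symm,
    fun k hi hj => h _ (hf.ne hi) (hf.ne hj)⟩⟩ rfl rfl
  by_cases hk : ∃ l, f l = k
  · obtain ⟨l, rfl⟩ := hk
    exact h.2 l (fun h => hi (h ▸ rfl)) (fun h => hj (h ▸ rfl))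
  · exact h.1 k (by simpa using hk)

lemma leg_eq_embedLegs (i : I) (Y : Op1 n) :
    leg i Y = embedLegs (fun _ : Fin 1 => i) (Y.submatrix (fun a => a 0) fun a => a 0) := by
  ext a b
  simp only [leg, embedLegs, submatrix_apply, Function.comp_apply, ne_eq, forall_const, eq_comm]

lemma legs_eq_embedLegs (i j : I) (X : Op2 n) :
    legs i j X = embedLegs ![i, j]
      (X.submatrix (finTwoArrowEquiv (Fin n)) (finTwoArrowEquiv (Fin n))) := by
  ext a b
  simp [legs, embedLegs, Fin.forall_fin_two, eq_comm]

lemma injective_pair {i j : I} (h : i ≠ j) : Function.Injective ![i, j] := by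
  intro k l
  fin_cases k <;> fin_cases l <;> simp [h, h.symm]

lemma legs_mul {i j : I} (h : i ≠ j) (X Y : Op2 n) :
    legs i j (X * Y) = legs i j X * legs i j Y := by
  simp only [legs_eq_embedLegs, ← embedLegs_mul (injective_pair h), submatrix_mul_equiv]

lemma legs_one (i j : I) : legs i j (1 : Op2 n) = 1 := by
  rw [legs_eq_embedLegs, submatrix_one_equiv, embedLegs_one]

lemma leg_mul (i : I) (X Y : Op1 n) : leg i (X * Y) = leg i X * leg i Y := by
  simp only [leg_eq_embedLegs]
  rw [← embedLegs_mul (Function.injective_of_subsingleton _)]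
  exact congrArg _ (submatrix_mul_equiv X Y _ (Equiv.funUnique (Fin 1) (Fin n)) _).symm

lemma leg_one (i : I) : leg i (1 : Op1 n) = 1 := by
  rw [leg_eq_embedLegs]
  exact (congrArg _ (submatrix_one_equiv (Equiv.funUnique (Fin 1) (Fin n)))).trans embedLegs_one

lemma leg_add (i : I) (X Y : Op1 n) : leg i (X + Y) = leg i X + leg i Y := by
  ext a b
  simp only [leg, Matrix.add_apply]
  split_ifs <;> simp

lemma leg_smul (i : I) (c : ℂ) (X : Op1 n) : leg i (c • X) = c • leg i X := by
  ext a b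
  simp [leg]

/-- `Y ↦ Yᵢ` as a homomorphism of algebras. -/
def legHom (i : I) : Op1 n →ₐ[ℂ] OpT I n :=
  AlgHom.ofLinearMap { toFun := leg i, map_add' := leg_add i, map_smul' := leg_smul i }
    (leg_one i) (leg_mul i)

lemma commute_leg {i j : I} (h : i ≠ j) (X Y : Op1 n) : Commute (leg i X) (leg j Y) := by
  rw [leg_eq_embedLegs, leg_eq_embedLegs]
  exact commute_embedLegs (Function.injective_of_subsingleton _)
    (Function.injective_of_subsingleton _) (fun _ _ => h) _ _

lemma commute_legs {i j k l : I} (hij : i ≠ j) (hkl : k ≠ l) (hik : i ≠ k) (hil : i ≠ l)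
    (hjk : j ≠ k) (hjl : j ≠ l) (X Y : Op2 n) : Commute (legs i j X) (legs k l Y) := by
  rw [legs_eq_embedLegs, legs_eq_embedLegs]
  refine commute_embedLegs (injective_pair hij) (injective_pair hkl) ?_ _ _
  simp [Fin.forall_fin_two, *]

lemma legs_mul_apply {i j : I} (h : i ≠ j) (X : Op2 n) (Y : OpT I n) (a b) :
    (legs i j X * Y) a b =
      ∑ u, ∑ w, X (a i, a j) (u, w) * Y (Function.update (Function.update a i u) j w) b := by
  rw [legs_eq_embedLegs, embedLegs_mul_apply (injective_pair h),
    ← (finTwoArrowEquiv (Fin n)).symm.sum_comp, Fintype.sum_prod_type]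
  refine Finset.sum_congr rfl fun u _ => Finset.sum_congr rfl fun w _ => ?_
  have : Function.extend ![i, j] ((finTwoArrowEquiv (Fin n)).symm (u, w)) a =
      Function.update (Function.update a i u) j w := by
    ext k : 1
    by_cases hj : k = j
    · subst hj
      rw [Function.update_self]
      exact (injective_pair h).extend_apply _ _ 1
    · rw [Function.update_of_ne hj]
      by_cases hi : k = i
      · subst hi
        rw [Function.update_self]
        exact (injective_pair h).extend_apply _ _ 0
      · rw [Function.update_of_ne hi, Function.extend_apply']
        simp [Fin.exists_fin_two, Ne.symm hi, Ne.symm hj]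
  rw [this]
  simp

/-! ### Flips and relabelling of legs. -/

lemma legs_swapLegs (i j : I) (X : Op2 n) : legs i j (swapLegs X) = legs j i X := by
  ext a b
  simp only [legs, swapLegs_apply, Prod.swap_prod_mk]
  refine if_congr (forall_congr' fun k => ?_) rfl rfl
  tauto

lemma legs_flipOp_mul_apply {i j : I} (h : i ≠ j) (Y : OpT I n) (a b) :
    (legs i j (flipOp n) * Y) a b = Y (a ∘ Equiv.swap i j) b := by
  rw [legs_mul_apply h, Finset.sum_eq_single (a j), Finset.sum_eq_single (a i)]
  · have : Function.update (Function.update a i (a j)) j (a i) = a ∘ Equiv.swap i j := by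
      ext k : 1
      simp only [Function.update_apply, Function.comp_apply, Equiv.swap_apply_def]
      split_ifs <;> simp_all
    rw [this, flipOp_apply]; simp
  · intro w _ hw
    rw [flipOp_apply, if_neg (by simp [hw.symm]), zero_mul]
  · simp
  · intro u _ hu
    refine Finset.sum_eq_zero fun w _ => ?_
    rw [flipOp_apply, if_neg (by simp [hu.symm]), zero_mul]
  · simp

lemma mul_legs_flipOp_apply {i j : I} (h : i ≠ j) (Y : OpT I n) (a b) :
    (Y * legs i j (flipOp n)) a b = Y a (b ∘ Equiv.swap i j) := by
  -- The flip is symmetric, so transposition converts left multiplication into right multiplication.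
  have ht : (legs i j (flipOp n))ᵀ = legs i j (flipOp n) := by
    ext a b
    simp only [legs, transpose_apply, flipOp_apply, Prod.swap_prod_mk, Prod.mk.injEq]
    simp only [eq_comm, and_comm]
  have := legs_flipOp_mul_apply h Yᵀ b a
  rwa [← ht, ← transpose_mul] at this

/-- Conjugating with a flip permutes the legs. -/
lemma legs_mul_legs_flipOp {i j k l k' l' : I} (h : i ≠ j) (hk : Equiv.swap i j k = k')
    (hl : Equiv.swap i j l = l') (X : Op2 n) :
    legs k l X * legs i j (flipOp n) = legs i j (flipOp n) * legs k' l' X := by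
  ext a b
  rw [legs_flipOp_mul_apply h, mul_legs_flipOp_apply h]
  simp only [legs, Function.comp_apply, ← hk, ← hl, Equiv.swap_apply_self]
  refine if_congr ⟨fun H m hk hl => ?_, fun H m hk hl => ?_⟩ rfl rfl
  · have := H (Equiv.swap i j m) (fun e => hk (by rw [← e, Equiv.swap_apply_self]))
      (fun e => hl (by rw [← e, Equiv.swap_apply_self]))
    rwa [Equiv.swap_apply_self] at this
  · have := H (Equiv.swap i j m) (fun e => hk ((Equiv.swap i j).injective e))
      (fun e => hl ((Equiv.swap i j).injective e))
    rwa [Equiv.swap_apply_self] at this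

/-- The exchange relation `X₁₂ Y₁₃ Z₂₃ = Z₂₃ Y₁₃ X₁₂`. -/
def YBRel (X Y Z : Op2 n) : Prop :=
  (legs 0 1 X * legs 0 2 Y * legs 1 2 Z : OpT (Fin 3) n) = legs 1 2 Z * legs 0 2 Y * legs 0 1 X

/-- A relation on three legs transports along the injection of `Fin 3` that picks out `i, j, k`. -/
lemma YBRel.legs {X Y Z : Op2 n} (h : YBRel X Y Z) {i j k : I} (hij : i ≠ j) (hik : i ≠ k)
    (hjk : j ≠ k) :
    legs i j X * legs i k Y * legs j k Z = legs j k Z * legs i k Y * legs i j X := by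
  have hf : Function.Injective ![i, j, k] := by
    intro a b
    fin_cases a <;> fin_cases b <;> simp [hij, hik, hjk, hij.symm, hik.symm, hjk.symm]
  have := congrArg (embedLegs ![i, j, k]) h
  simp only [embedLegs_mul hf, embedLegs_legs hf] at this
  exact this

end Legs

/-! ### Splitting off auxiliary legs -/

section Split

variable {n N : ℕ}

/-- Operators on `⨂ V`, as matrices of operators on some of the legs. -/
def splitLegs {I α β : Type} [Fintype I] [DecidableEq I] [Fintype α] [DecidableEq α] [Fintype β]
    [DecidableEq β] (e : (I → Fin n) ≃ α × β) : OpT I n →+* Matrix α α (Matrix β β ℂ) where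
  toFun X := of fun a c => of fun b d => X (e.symm (a, b)) (e.symm (c, d))
  map_one' := by
    ext a c b d
    by_cases h : a = c <;> simp [one_apply, h]
  map_zero' := by ext; simp
  map_add' X Y := by ext; simp
  map_mul' X Y := by
    ext a c b d
    simp [mul_apply, Matrix.sum_apply, ← e.symm.sum_comp, Fintype.sum_prod_type]

/-- Splitting the legs `0` and `1` off three legs. -/
def splitThree (n : ℕ) : OpT (Fin 3) n →+* Matrix (Fin n × Fin n) (Fin n × Fin n) (Op1 n) :=
  splitLegs
    { toFun a := ((a 0, a 1), a 2)
      invFun p := ![p.1.1, p.1.2, p.2]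
      left_inv a := by ext k; fin_cases k <;> rfl
      right_inv p := rfl }

/-- Multi-indices with four entries, as pairs of pairs. -/
def fourEquiv (n : ℕ) : (Fin 4 → Fin n) ≃ (Fin n × Fin n) × (Fin n × Fin n) where
  toFun a := ((a 0, a 1), (a 2, a 3))
  invFun p := ![p.1.1, p.1.2, p.2.1, p.2.2]
  left_inv a := by ext k; fin_cases k <;> rfl
  right_inv p := rfl

/-- Splitting the legs `0` and `1` off four legs. -/
def splitFour (n : ℕ) : OpT (Fin 4) n →+* Matrix (Fin n × Fin n) (Fin n × Fin n) (Op2 n) :=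
  splitLegs (fourEquiv n)

/-- Splitting off the leg `0`. -/
def splitZero (n N : ℕ) : OpT (Fin (N + 1)) n →+* Matrix (Fin n) (Fin n) (OpT (Fin N) n) :=
  splitLegs (Fin.consEquiv fun _ => Fin n).symm

lemma splitThree_apply (X : OpT (Fin 3) n) (p q b d) :
    splitThree n X p q b d = X ![p.1, p.2, b] ![q.1, q.2, d] := rfl

lemma splitFour_apply (X : OpT (Fin 4) n) (p q b d) :
    splitFour n X p q b d = X ![p.1, p.2, b.1, b.2] ![q.1, q.2, d.1, d.2] := rfl

lemma splitZero_apply (X : OpT (Fin (N + 1)) n) (a c b d) :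
    splitZero n N X a c b d = X (Fin.cons a b) (Fin.cons c d) := rfl

/-- An operator on `V ⊗ V` as a matrix of operators on the second factor. -/
def blocks (X : Op2 n) : Matrix (Fin n) (Fin n) (Op1 n) :=
  of fun a c => of fun b d => X (a, b) (c, d)

lemma blocks_apply (X : Op2 n) (a c b d) : blocks X a c b d = X (a, b) (c, d) := rfl

lemma splitThree_legs_zero_one (X : Op2 n) : splitThree n (legs 0 1 X) = auxScalar _ X := by
  ext p q b d
  simp [splitThree_apply, legs, Fin.forall_fin_succ, algebraMap_matrix_apply]

lemma splitThree_legs_zero_two (X : Op2 n) : splitThree n (legs 0 2 X) = auxFst (blocks X) := by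
  ext p q b d
  by_cases h : p.2 = q.2 <;>
    simp [splitThree_apply, legs, Fin.forall_fin_succ, auxFst, blocks, h]

lemma splitThree_legs_one_two (X : Op2 n) : splitThree n (legs 1 2 X) = auxSnd (blocks X) := by
  ext p q b d
  by_cases h : p.1 = q.1 <;>
    simp [splitThree_apply, legs, Fin.forall_fin_succ, auxSnd, blocks, h]

lemma splitFour_legs_zero_one (X : Op2 n) : splitFour n (legs 0 1 X) = auxScalar _ X := by
  ext p q b d
  simp [splitFour_apply, legs, Fin.forall_fin_succ, algebraMap_matrix_apply, Prod.ext_iff]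

lemma splitFour_legs_zero_two (X : Op2 n) :
    splitFour n (legs 0 2 X) = auxFst ((blocks X).map fst) := by
  ext p q b d
  by_cases h : p.2 = q.2 <;> by_cases h' : b.2 = d.2 <;>
    simp [splitFour_apply, legs, Fin.forall_fin_succ, auxFst, blocks, fst, one_apply, h, h']

lemma splitFour_legs_one_three (X : Op2 n) :
    splitFour n (legs 1 3 X) = auxSnd ((blocks X).map snd) := by
  ext p q b d
  by_cases h : p.1 = q.1 <;> by_cases h' : b.1 = d.1 <;>
    simp [splitFour_apply, legs, Fin.forall_fin_succ, auxSnd, blocks, snd, one_apply, h, h']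

/-- In the four-leg picture the traces run over legs 0 and 1 and the reflection equation lives on
legs 2 and 3, so operators on the latter pair are scalars for the trace. -/
lemma splitFour_legs_two_three (X : Op2 n) :
    splitFour n (legs 2 3 X) = scalar (Fin n × Fin n) X := by
  ext p q b d
  by_cases h : p = q
  · subst h; simp [splitFour_apply, legs, Fin.forall_fin_succ]
  · have : ¬ (p.1 = q.1 ∧ p.2 = q.2) := fun H => h (Prod.ext H.1 H.2)
    simp [splitFour_apply, legs, Fin.forall_fin_succ, h, this]

lemma splitZero_leg_zero (Y : Op1 n) : splitZero n N (leg 0 Y) = auxScalar _ Y := by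
  ext a c b d
  simp [splitZero_apply, leg, Fin.forall_fin_succ, algebraMap_matrix_apply, funext_iff]

lemma splitZero_legs_zero_succ (i : Fin N) (X : Op2 n) :
    splitZero n N (legs 0 i.succ X) = (blocks X).map (leg i) := by
  ext a c b d
  simp [splitZero_apply, legs, leg, Fin.forall_fin_succ, blocks, Fin.succ_inj]

lemma trZero_eq_trace (X : OpT (Fin (N + 1)) n) : trZero X = trace (splitZero n N X) := by
  ext b d
  simp [trZero, trace, Matrix.sum_apply, splitZero_apply]

/-- Legs 0 and 1 become auxiliary and leg 2 becomes the quantum space: Yang–Baxter read as an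
exchange relation of RLL type. -/
lemma YBRel.blocks {X Y Z : Op2 n} (h : YBRel X Y Z) :
    auxScalar _ X * auxFst (blocks Y) * auxSnd (blocks Z) =
      auxSnd (_root_.blocks Z) * auxFst (_root_.blocks Y) * auxScalar _ X := by
  have := congrArg (splitThree n) h
  simpa only [map_mul, splitThree_legs_zero_one, splitThree_legs_zero_two,
    splitThree_legs_one_two] using this

end Split

/-! ### The dual reflection equation -/

section Dual

variable {n : ℕ}

lemma ptr1_apply (X : Op2 n) (a b) : ptr1 X a b = X (b.1, a.2) (a.1, b.2) := rfl

/-- Each of the four legs meets two factors, leaving one free contraction per leg; all other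
intermediate indices are forced. -/
lemma legs_product_apply (X Y Z T : Op2 n) (a b c d i j k l : Fin n) :
    (legs 1 2 X * legs 1 3 Y * legs 0 2 Z * legs 0 3 T : OpT (Fin 4) n)
        ![i, j, c, d] ![a, b, k, l] =
      ∑ e, ∑ u, ∑ w, ∑ f, X (j, c) (e, u) * Y (e, d) (b, w) * Z (i, u) (f, k) * T (f, w) (a, l) := by
  simp only [mul_assoc]
  rw [legs_mul_apply (by decide)]
  refine Finset.sum_congr rfl fun e _ => Finset.sum_congr rfl fun u _ => ?_
  rw [legs_mul_apply (by decide), Finset.sum_eq_single b]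
  · rw [Finset.mul_sum]
    refine Finset.sum_congr rfl fun w _ => ?_
    rw [legs_mul_apply (by decide), Finset.mul_sum, Finset.mul_sum]
    refine Finset.sum_congr rfl fun f _ => ?_
    rw [Finset.sum_eq_single k]
    · simp [legs, Fin.forall_fin_succ, Function.update_apply]
    · intro t _ ht
      simp [legs, Fin.forall_fin_succ, Function.update_apply, ht]
    · simp
  · intro v _ hv
    refine Finset.sum_eq_zero fun w _ => ?_
    rw [legs_mul_apply (by decide)]
    simp [legs, Fin.forall_fin_succ, Function.update_apply, hv]
  · simp

lemma legs_product_apply' (X Y Z T : Op2 n) (a b c d i j k l : Fin n) :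
    (legs 1 3 X * legs 1 2 Y * legs 0 3 Z * legs 0 2 T : OpT (Fin 4) n)
        ![a, b, c, d] ![i, j, k, l] =
      ∑ e, ∑ u, ∑ w, ∑ f, X (b, d) (e, u) * Y (e, c) (j, w) * Z (a, u) (f, l) * T (f, w) (i, k) := by
  simp only [mul_assoc]
  rw [legs_mul_apply (by decide)]
  refine Finset.sum_congr rfl fun e _ => Finset.sum_congr rfl fun u _ => ?_
  rw [legs_mul_apply (by decide), Finset.sum_eq_single j]
  · rw [Finset.mul_sum]
    refine Finset.sum_congr rfl fun w _ => ?_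
    rw [legs_mul_apply (by decide), Finset.mul_sum, Finset.mul_sum]
    refine Finset.sum_congr rfl fun f _ => ?_
    rw [Finset.sum_eq_single l]
    · simp [legs, Fin.forall_fin_succ, Function.update_apply]
    · intro t _ ht
      simp [legs, Fin.forall_fin_succ, Function.update_apply, ht]
    · simp
  · intro v _ hv
    refine Finset.sum_eq_zero fun w _ => ?_
    rw [legs_mul_apply (by decide)]
    simp [legs, Fin.forall_fin_succ, Function.update_apply, hv]
  · simp

/-- The partial transpose of a product in the legs `0` and `1`. -/
lemma legs_product_ptr1 (S X Y : Op2 n) (a b c d i j k l : Fin n) :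
    (legs 1 2 S * legs 1 3 Y * legs 0 2 X * legs 0 3 S : OpT (Fin 4) n)
        ![i, j, c, d] ![a, b, k, l] =
      (legs 1 3 (ptr1 Y) * legs 1 2 (ptr1 S) * legs 0 3 (ptr1 S) * legs 0 2 (ptr1 X) :
        OpT (Fin 4) n) ![a, b, c, d] ![i, j, k, l] := by
  rw [legs_product_apply, legs_product_apply']
  refine Finset.sum_congr rfl fun e _ => ?_
  -- Transposing legs 0 and 1 reverses the factors meeting in those legs but not in legs 2 and 3. In
  -- the two expansions this exchanges the bound indices `u` and `w`.
  rw [Finset.sum_comm]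
  refine Finset.sum_congr rfl fun u _ => Finset.sum_congr rfl fun w _ =>
    Finset.sum_congr rfl fun f _ => ?_
  simp only [ptr1_apply]
  ring

lemma isUnit_legs {I : Type} [Fintype I] [DecidableEq I] {i j : I} (h : i ≠ j) {X : Op2 n}
    (hX : IsUnit X) : IsUnit (legs i j X : OpT I n) :=
  hX.map ({ toFun := legs i j, map_one' := legs_one i j, map_mul' := legs_mul h } :
    Op2 n →* OpT I n)

/-- The operator through which the reflection equation and the dual one are related. -/
def dualKernel (S X Y : Op2 n) : OpT (Fin 4) n :=
  legs 0 2 (flipOp n) * (legs 1 3 (flipOp n) *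
    (legs 1 2 S * legs 1 3 Y * legs 0 2 X * legs 0 3 S))

lemma dualKernel_apply (S X Y : Op2 n) (c d i j : Fin n) (b) :
    dualKernel S X Y ![c, d, i, j] b =
      (legs 1 2 S * legs 1 3 Y * legs 0 2 X * legs 0 3 S : OpT (Fin 4) n) ![i, j, c, d] b := by
  have h : (![c, d, i, j] ∘ Equiv.swap (0 : Fin 4) 2) ∘ Equiv.swap (1 : Fin 4) 3 =
      ![i, j, c, d] := by
    ext k : 1
    fin_cases k <;> simp [Equiv.swap_apply_def]
  rw [dualKernel, legs_flipOp_mul_apply (by decide), legs_flipOp_mul_apply (by decide), h]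

/-- Regarded as a row vector indexed by four legs, `D` enters the trace through right multiplication
by a product of partial transposes. That product is invertible, so `D` can be recovered. -/
lemma eq_of_trace_dualKernel_eq {S X Y D D' : Op2 n} (hS : IsUnit (ptr1 S)) (hX : IsUnit (ptr1 X))
    (hY : IsUnit (ptr1 Y))
    (h : trace (auxScalar _ D * splitFour n (dualKernel S X Y)) =
      trace (auxScalar _ D' * splitFour n (dualKernel S X Y))) : D = D' := by
  set Q : OpT (Fin 4) n :=
    legs 1 3 (ptr1 Y) * legs 1 2 (ptr1 S) * legs 0 3 (ptr1 S) * legs 0 2 (ptr1 X) with hQ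
  have hQu : IsUnit Q := (((isUnit_legs (by decide) hY).mul (isUnit_legs (by decide) hS)).mul
    (isUnit_legs (by decide) hS)).mul (isUnit_legs (by decide) hX)
  have key : ∀ (E : Op2 n) (y : Fin 4 → Fin n),
      trace (auxScalar (Op2 n) E * splitFour n (dualKernel S X Y)) (y 0, y 1) (y 2, y 3) =
        ((fun x : Fin 4 → Fin n => E (x 0, x 1) (x 2, x 3)) ᵥ* Q) y := by
    intro E y
    rw [vecMul, dotProduct, ← (fourEquiv n).symm.sum_comp, Fintype.sum_prod_type, trace,
      Matrix.sum_apply]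
    refine Finset.sum_congr rfl fun p _ => ?_
    rw [diag_apply, mul_apply, Matrix.sum_apply]
    refine Finset.sum_congr rfl fun q _ => ?_
    rw [auxScalar_apply, ← Algebra.smul_def, Matrix.smul_apply, splitFour_apply, dualKernel_apply,
      legs_product_ptr1, smul_eq_mul]
    have hy : y = ![y 0, y 1, y 2, y 3] := by ext k : 1; fin_cases k <;> rfl
    conv_rhs => rw [hy]
    rfl
  have hv : (fun x : Fin 4 → Fin n => D (x 0, x 1) (x 2, x 3)) =
      fun x => D' (x 0, x 1) (x 2, x 3) := by
    refine vecMul_injective_of_isUnit hQu (funext fun y => ?_)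
    change ((fun x : Fin 4 → Fin n => D (x 0, x 1) (x 2, x 3)) ᵥ* Q) y =
      ((fun x : Fin 4 → Fin n => D' (x 0, x 1) (x 2, x 3)) ᵥ* Q) y
    rw [← key, ← key, h]
  ext ⟨a, b⟩ ⟨c, d⟩
  exact congrFun hv ![a, b, c, d]

lemma mul_trace_eq {A κ : Type} [Ring A] [Fintype κ] [DecidableEq κ] (g : A) (Z : Matrix κ κ A) :
    g * trace Z = trace (scalar κ g * Z) := by
  simp [trace, Finset.mul_sum]

lemma trace_mul_eq {A κ : Type} [Ring A] [Fintype κ] [DecidableEq κ] (g : A) (Z : Matrix κ κ A) :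
    trace Z * g = trace (Z * scalar κ g) := by
  simp [trace, Finset.sum_mul]

lemma commute_scalar_auxScalar {A κ : Type} [Ring A] [Algebra ℂ A] [Fintype κ] [DecidableEq κ]
    (g : A) (X : Matrix κ κ ℂ) : Commute (scalar κ g) (auxScalar A X) := by
  ext i j
  simp [(Algebra.commutes _ _).symm]

lemma auxFst_scalar {A : Type} [Ring A] (g : A) :
    auxFst (scalar (Fin n) g) = scalar (Fin n × Fin n) g := by
  ext ⟨a, b⟩ ⟨c, d⟩
  by_cases h : b = d <;> simp [auxFst, diagonal_apply, h]

lemma auxSnd_scalar {A : Type} [Ring A] (g : A) :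
    auxSnd (scalar (Fin n) g) = scalar (Fin n × Fin n) g := by
  ext ⟨a, b⟩ ⟨c, d⟩
  by_cases h : a = c <;> simp [auxSnd, diagonal_apply, h]

lemma fst_apply (K : Op1 n) (p q) : fst K p q = if p.2 = q.2 then K p.1 q.1 else 0 := by
  simp [fst, one_apply]

lemma snd_apply (K : Op1 n) (p q) : snd K p q = if p.1 = q.1 then K p.2 q.2 else 0 := by
  simp [snd, one_apply]

lemma trFst_apply_eq (K : Op1 n) (X : Op2 n) (b d : Fin n) :
    trFst (fst K * flipOp n * X) b d = ∑ a, ∑ c, K a c * (flipOp n * X) (c, b) (a, d) := by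
  rw [trFst]
  refine Finset.sum_congr rfl fun a _ => ?_
  rw [mul_assoc, mul_apply, Fintype.sum_prod_type]
  refine Finset.sum_congr rfl fun c _ => ?_
  simp [fst, one_apply]

/-- Presents K⁺, acting on one leg of the reflection equation, as a trace over an additional
auxiliary leg. -/
lemma fst_trFst (K : Op1 n) (X : Op2 n) :
    fst (trFst (fst K * flipOp n * X)) =
      trace (auxScalar _ K * (blocks (flipOp n * X)).map fst) := by
  ext p q
  rw [trace, Matrix.sum_apply]
  simp only [diag_apply, mul_apply (M := auxScalar _ K), Matrix.sum_apply, auxScalar_apply,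
    ← Algebra.smul_def, Matrix.smul_apply, map_apply, smul_eq_mul]
  simp only [fst_apply, trFst_apply_eq, blocks_apply]
  by_cases h : p.2 = q.2 <;> simp [h]

lemma snd_trFst (K : Op1 n) (X : Op2 n) :
    snd (trFst (fst K * flipOp n * X)) =
      trace (auxScalar _ K * (blocks (flipOp n * X)).map snd) := by
  ext p q
  rw [trace, Matrix.sum_apply]
  simp only [diag_apply, mul_apply (M := auxScalar _ K), Matrix.sum_apply, auxScalar_apply,
    ← Algebra.smul_def, Matrix.smul_apply, map_apply, smul_eq_mul]
  simp only [snd_apply, trFst_apply_eq, blocks_apply]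
  by_cases h : p.1 = q.1 <;> simp [h]

/-- Pulling the first factor of the dual reflection equation out of the reflection equation. -/
lemma legs_mul_eq_dualKernel_mul {Q S X Y : Op2 n} (h₁ : YBRel Q X S) (h₂ : YBRel Q S Y) :
    (legs 2 3 Q * legs 0 2 (flipOp n * X) * legs 0 1 S * legs 2 3 (swapLegs S) *
        legs 1 3 (flipOp n * Y) : OpT (Fin 4) n) = dualKernel S X Y * legs 0 1 Q := by
  have c1 : (legs 3 2 S * legs 1 3 (flipOp n) : OpT (Fin 4) n) =
      legs 1 3 (flipOp n) * legs 1 2 S :=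
    legs_mul_legs_flipOp (by decide) (by decide) (by decide) S
  have c2 : (legs 0 1 S * legs 1 3 (flipOp n) : OpT (Fin 4) n) =
      legs 1 3 (flipOp n) * legs 0 3 S :=
    legs_mul_legs_flipOp (by decide) (by decide) (by decide) S
  have c3 : (legs 0 2 X * legs 1 3 (flipOp n) : OpT (Fin 4) n) =
      legs 1 3 (flipOp n) * legs 0 2 X :=
    legs_mul_legs_flipOp (by decide) (by decide) (by decide) X
  have c4 : (legs 2 3 Q * legs 0 2 (flipOp n) : OpT (Fin 4) n) =
      legs 0 2 (flipOp n) * legs 0 3 Q :=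
    legs_mul_legs_flipOp (by decide) (by decide) (by decide) Q
  have c5 : (legs 0 3 Q * legs 1 3 (flipOp n) : OpT (Fin 4) n) =
      legs 1 3 (flipOp n) * legs 0 1 Q :=
    legs_mul_legs_flipOp (by decide) (by decide) (by decide) Q
  have c6 : (legs 0 3 S * legs 1 2 S : OpT (Fin 4) n) = legs 1 2 S * legs 0 3 S :=
    commute_legs (by decide) (by decide) (by decide) (by decide) (by decide) (by decide) S S
  have c7 : (legs 0 2 X * legs 1 3 Y : OpT (Fin 4) n) = legs 1 3 Y * legs 0 2 X :=
    commute_legs (by decide) (by decide) (by decide) (by decide) (by decide) (by decide) X Y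
  have y1 := h₁.legs (I := Fin 4) (i := 0) (j := 1) (k := 2) (by decide) (by decide) (by decide)
  have y2 := h₂.legs (I := Fin 4) (i := 0) (j := 1) (k := 3) (by decide) (by decide) (by decide)
  rw [legs_swapLegs, legs_mul (by decide), legs_mul (by decide), dualKernel]
  simp only [← mul_assoc]
  generalize (legs 0 2 (flipOp n) : OpT (Fin 4) n) = P02 at *
  generalize (legs 1 3 (flipOp n) : OpT (Fin 4) n) = P13 at *
  generalize (legs 3 2 S : OpT (Fin 4) n) = S32 at *
  generalize (legs 1 2 S : OpT (Fin 4) n) = S12 at *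
  generalize (legs 0 1 S : OpT (Fin 4) n) = S01 at *
  generalize (legs 0 3 S : OpT (Fin 4) n) = S03 at *
  generalize (legs 0 2 X : OpT (Fin 4) n) = X02 at *
  generalize (legs 1 3 Y : OpT (Fin 4) n) = Y13 at *
  generalize (legs 2 3 Q : OpT (Fin 4) n) = Q23 at *
  generalize (legs 0 3 Q : OpT (Fin 4) n) = Q03 at *
  generalize (legs 0 1 Q : OpT (Fin 4) n) = Q01 at *
  -- Both flips are carried to the left, relabelling the legs they pass. This turns `Q23` into
  -- `Q01`, which two Yang–Baxter moves then take through to the right end.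
  calc Q23 * P02 * X02 * S01 * S32 * P13 * Y13
      = Q23 * P02 * X02 * S01 * (S32 * P13) * Y13 := by simp only [mul_assoc]
    _ = Q23 * P02 * X02 * (S01 * P13) * S12 * Y13 := by rw [c1]; simp only [mul_assoc]
    _ = Q23 * P02 * (X02 * P13) * S03 * S12 * Y13 := by rw [c2]; simp only [mul_assoc]
    _ = (Q23 * P02) * P13 * X02 * (S03 * S12) * Y13 := by rw [c3]; simp only [mul_assoc]
    _ = P02 * (Q03 * P13) * X02 * S12 * S03 * Y13 := by rw [c4, c6]; simp only [mul_assoc]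
    _ = P02 * P13 * (Q01 * X02 * S12) * S03 * Y13 := by rw [c5]; simp only [mul_assoc]
    _ = P02 * P13 * S12 * X02 * (Q01 * S03 * Y13) := by rw [y1]; simp only [mul_assoc]
    _ = P02 * P13 * S12 * (X02 * Y13) * S03 * Q01 := by rw [y2]; simp only [mul_assoc]
    _ = P02 * P13 * S12 * Y13 * X02 * S03 * Q01 := by rw [c7]; simp only [mul_assoc]

/-- Pulling the last factor of the dual reflection equation out of the reflection equation. -/
lemma legs_mul_eq_mul_dualKernel {Q S X Y : Op2 n} (h₁ : YBRel Y S Q) (h₂ : YBRel S X Q) :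
    (legs 1 3 (flipOp n * Y) * legs 0 1 (swapLegs S) * legs 2 3 S * legs 0 2 (flipOp n * X) *
        legs 2 3 (swapLegs Q) : OpT (Fin 4) n) = legs 0 1 (swapLegs Q) * dualKernel S X Y := by
  have c1 : (legs 2 3 S * legs 0 2 (flipOp n) : OpT (Fin 4) n) =
      legs 0 2 (flipOp n) * legs 0 3 S :=
    legs_mul_legs_flipOp (by decide) (by decide) (by decide) S
  have c2 : (legs 1 0 S * legs 0 2 (flipOp n) : OpT (Fin 4) n) =
      legs 0 2 (flipOp n) * legs 1 2 S :=
    legs_mul_legs_flipOp (by decide) (by decide) (by decide) S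
  have c3 : (legs 1 3 Y * legs 0 2 (flipOp n) : OpT (Fin 4) n) =
      legs 0 2 (flipOp n) * legs 1 3 Y :=
    legs_mul_legs_flipOp (by decide) (by decide) (by decide) Y
  have c4 : (legs 1 3 (flipOp n) * legs 0 2 (flipOp n) : OpT (Fin 4) n) =
      legs 0 2 (flipOp n) * legs 1 3 (flipOp n) :=
    legs_mul_legs_flipOp (by decide) (by decide) (by decide) (flipOp n)
  have c5 : (legs 1 3 (flipOp n) * legs 3 2 Q : OpT (Fin 4) n) =
      legs 1 2 Q * legs 1 3 (flipOp n) :=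
    (legs_mul_legs_flipOp (by decide) (by decide) (by decide) Q).symm
  have c6 : (legs 0 2 (flipOp n) * legs 1 2 Q : OpT (Fin 4) n) =
      legs 1 0 Q * legs 0 2 (flipOp n) :=
    (legs_mul_legs_flipOp (by decide) (by decide) (by decide) Q).symm
  have y1 := h₁.legs (I := Fin 4) (i := 1) (j := 3) (k := 2) (by decide) (by decide) (by decide)
  have y2 := h₂.legs (I := Fin 4) (i := 0) (j := 3) (k := 2) (by decide) (by decide) (by decide)
  rw [legs_swapLegs, legs_swapLegs, legs_swapLegs, legs_mul (by decide), legs_mul (by decide),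
    dualKernel]
  simp only [← mul_assoc]
  generalize (legs 0 2 (flipOp n) : OpT (Fin 4) n) = P02 at *
  generalize (legs 1 3 (flipOp n) : OpT (Fin 4) n) = P13 at *
  generalize (legs 1 0 S : OpT (Fin 4) n) = S10 at *
  generalize (legs 2 3 S : OpT (Fin 4) n) = S23 at *
  generalize (legs 1 2 S : OpT (Fin 4) n) = S12 at *
  generalize (legs 0 3 S : OpT (Fin 4) n) = S03 at *
  generalize (legs 0 2 X : OpT (Fin 4) n) = X02 at *
  generalize (legs 1 3 Y : OpT (Fin 4) n) = Y13 at *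
  generalize (legs 3 2 Q : OpT (Fin 4) n) = Q32 at *
  generalize (legs 1 2 Q : OpT (Fin 4) n) = Q12 at *
  generalize (legs 1 0 Q : OpT (Fin 4) n) = Q10 at *
  calc P13 * Y13 * S10 * S23 * P02 * X02 * Q32
      = P13 * Y13 * S10 * (S23 * P02) * X02 * Q32 := by simp only [mul_assoc]
    _ = P13 * Y13 * (S10 * P02) * S03 * X02 * Q32 := by rw [c1]; simp only [mul_assoc]
    _ = P13 * (Y13 * P02) * S12 * S03 * X02 * Q32 := by rw [c2]; simp only [mul_assoc]
    _ = (P13 * P02) * Y13 * S12 * (S03 * X02 * Q32) := by rw [c3]; simp only [mul_assoc]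
    _ = P02 * P13 * (Y13 * S12 * Q32) * X02 * S03 := by rw [c4, y2]; simp only [mul_assoc]
    _ = P02 * (P13 * Q32) * S12 * Y13 * X02 * S03 := by rw [y1]; simp only [mul_assoc]
    _ = (P02 * Q12) * P13 * S12 * Y13 * X02 * S03 := by rw [c5]; simp only [mul_assoc]
    _ = Q10 * P02 * P13 * S12 * Y13 * X02 * S03 := by rw [c6]

/-- The reflection equation for `φ_R(K)` implies the dual reflection equation for `K`. -/
theorem dual_reflection {Q S St X Y : Op2 n} {K L : Op1 n}
    (h₁ : YBRel Q X S) (h₂ : YBRel Q S Y) (h₃ : YBRel Y S Q) (h₄ : YBRel S X Q)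
    (hS : IsUnit (ptr1 S)) (hX : IsUnit (ptr1 X)) (hY : IsUnit (ptr1 Y))
    (hSt : ptr1 St * ptr1 S = 1)
    (href : Q * fst (trFst (fst K * flipOp n * X)) * swapLegs S *
        snd (trFst (fst L * flipOp n * Y)) =
      snd (trFst (fst L * flipOp n * Y)) * S * fst (trFst (fst K * flipOp n * X)) * swapLegs Q) :
    Q * snd L * St * fst K = fst K * swapLegs St * snd L * swapLegs Q := by
  apply eq_of_trace_dualKernel_eq hS hX hY
  rw [fst_trFst, snd_trFst] at href
  have e1 := splitFour_legs_zero_two (flipOp n * X)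
  have e2 := splitFour_legs_one_three (flipOp n * Y)
  set U := (blocks (flipOp n * X)).map fst
  set W := (blocks (flipOp n * Y)).map snd
  -- `trace_insert` merges the two traces and supplies `S` on legs 0 and 1. Pulling `Q` through the
  -- kernel moves it from legs 2, 3 to legs 0, 1, and cyclicity then puts it in front of the dual
  -- expression.
  have hl : Q * trace (auxScalar _ K * U) * swapLegs S * trace (auxScalar _ L * W) =
      trace (auxScalar _ (Q * snd L * St * fst K) * splitFour n (dualKernel S X Y)) := by
    rw [trace_auxScalar_mul_comm L, mul_assoc, mul_trace_eq (swapLegs S), mul_assoc,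
      ← trace_insert hSt, mul_trace_eq Q, auxFst_mul, auxSnd_mul, auxSnd_mul, auxSnd_scalar,
      auxFst_auxScalar, auxSnd_auxScalar]
    have := congrArg (splitFour n) (legs_mul_eq_dualKernel_mul h₁ h₂)
    simp only [map_mul, splitFour_legs_zero_one, splitFour_legs_two_three, e1, e2] at this
    calc _ = trace (scalar _ Q * auxScalar _ St * auxScalar _ (fst K) * auxFst U * auxScalar _ S *
            scalar _ (swapLegs S) * auxSnd W * auxScalar _ (snd L)) := by simp only [mul_assoc]
      _ = trace (auxScalar _ (snd L * St * fst K) * (scalar _ Q * auxFst U * auxScalar _ S *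
            scalar _ (swapLegs S) * auxSnd W)) := by
          rw [← trace_auxScalar_mul_comm, mul_assoc (scalar _ Q), ← map_mul,
            (commute_scalar_auxScalar _ _).eq]
          simp only [map_mul, mul_assoc]
      _ = trace (auxScalar _ (Q * (snd L * St * fst K)) * splitFour n (dualKernel S X Y)) := by
          rw [this, ← mul_assoc, ← trace_auxScalar_mul_comm, ← mul_assoc, ← map_mul]
      _ = _ := by simp only [mul_assoc]
  -- The mirror computation: here the traces come in the opposite order and `swapLegs Q` leaves the
  -- kernel on the left.
  have hr : trace (auxScalar _ L * W) * S * trace (auxScalar _ K * U) * swapLegs Q =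
      trace (auxScalar _ (fst K * swapLegs St * snd L * swapLegs Q) *
        splitFour n (dualKernel S X Y)) := by
    rw [trace_auxScalar_mul_comm K, mul_assoc (trace _) S, mul_trace_eq S,
      ← trace_insert_swap hSt, trace_mul_eq (swapLegs Q), auxFst_mul, auxFst_mul, auxSnd_mul,
      auxFst_scalar, auxFst_auxScalar, auxSnd_auxScalar]
    have := congrArg (splitFour n) (legs_mul_eq_mul_dualKernel h₃ h₄)
    simp only [map_mul, splitFour_legs_zero_one, splitFour_legs_two_three, e1, e2] at this
    calc _ = trace (auxScalar _ (swapLegs St * snd L) * (auxSnd W * auxScalar _ (swapLegs S) *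
            scalar _ S * auxFst U * (auxScalar _ (fst K) * scalar _ (swapLegs Q)))) := by
          simp only [map_mul, mul_assoc]
      _ = trace (auxScalar _ (fst K) * (auxScalar _ (swapLegs St * snd L) *
            (auxSnd W * auxScalar _ (swapLegs S) * scalar _ S * auxFst U *
              scalar _ (swapLegs Q)))) := by
          rw [← (commute_scalar_auxScalar _ _).eq, trace_auxScalar_mul_comm (fst K)]
          simp only [mul_assoc]
      _ = _ := by
          rw [this]
          simp only [map_mul, mul_assoc]
  rw [← hl, ← hr, href]

end Dual

/-! ### Monodromy matrices -/

section Monodromy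

variable {n N : ℕ} {I : Type} [Fintype I] [DecidableEq I]

/-- The operator `X₀ᵢ`, as a matrix over the auxiliary space `0`. -/
def site (i : I) (X : Op2 n) : Matrix (Fin n) (Fin n) (OpT I n) := (blocks X).map (leg i)

/-- The relation `YBRel.blocks` with the algebra homomorphism `legHom i` applied to every entry. -/
lemma exchange_site {X Y Z : Op2 n} (h : YBRel X Y Z) (i : I) :
    auxScalar _ X * auxFst (site i Y) * auxSnd (site i Z) =
      auxSnd (site i Z) * auxFst (site i Y) * auxScalar _ X := by
  have := congrArg ((legHom i : Op1 n →ₐ[ℂ] OpT I n).mapMatrix) h.blocks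
  have e1 : (legHom i).mapMatrix (auxScalar (Op1 n) X) = auxScalar (OpT I n) X := by
    ext p q : 1
    exact (legHom i).commutes _
  have e2 : ∀ Y : Op2 n, (legHom i).mapMatrix (auxFst (blocks Y)) = auxFst (site i Y) := by
    intro Y
    ext p q : 1
    simp only [AlgHom.mapMatrix_apply, map_apply, auxFst, of_apply, apply_ite (legHom i), map_zero]
    rfl
  have e3 : ∀ Y : Op2 n, (legHom i).mapMatrix (auxSnd (blocks Y)) = auxSnd (site i Y) := by
    intro Y
    ext p q : 1
    simp only [AlgHom.mapMatrix_apply, map_apply, auxSnd, of_apply, apply_ite (legHom i), map_zero]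
    rfl
  simpa only [map_mul, e1, e2, e3] using this

lemma commute_site {i j : I} (h : i ≠ j) (Y Z : Op2 n) :
    Commute (auxFst (site i Y)) (auxSnd (site j Z)) :=
  commute_auxFst_auxSnd fun _ _ _ _ => commute_leg h _ _

lemma commute_site_prod {i : I} {l : List I} (h : i ∉ l) (Y : Op2 n) (Z : I → Op2 n) :
    Commute (auxFst (site i Y)) (auxSnd (l.map fun j => site j (Z j)).prod) := by
  induction l with
  | nil => simp [auxSnd_one]
  | cons j l ih =>
    rw [List.mem_cons, not_or] at h
    rw [List.map_cons, List.prod_cons, auxSnd_mul]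
    exact (commute_site h.1 _ _).mul_right (ih h.2)

lemma commute_prod_site {i : I} {l : List I} (h : i ∉ l) (Y : I → Op2 n) (Z : Op2 n) :
    Commute (auxFst (l.map fun j => site j (Y j)).prod) (auxSnd (site i Z)) := by
  induction l with
  | nil => simp [auxFst_one]
  | cons j l ih =>
    rw [List.mem_cons, not_or] at h
    rw [List.map_cons, List.prod_cons, auxFst_mul]
    exact (commute_site (Ne.symm h.1) _ _).mul_left (ih h.2)

/-- The train argument: `X` passes the sites one at a time. Distinctness of the sites is what lets
the two monodromies be interleaved. -/
lemma exchange_prod {X : Op2 n} {Y Z : I → Op2 n} (h : ∀ i, YBRel X (Y i) (Z i)) {l : List I}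
    (hl : l.Nodup) :
    auxScalar _ X * auxFst (l.map fun i => site i (Y i)).prod *
        auxSnd (l.map fun i => site i (Z i)).prod =
      auxSnd (l.map fun i => site i (Z i)).prod * auxFst (l.map fun i => site i (Y i)).prod *
        auxScalar _ X := by
  induction l with
  | nil => simp [auxFst_one, auxSnd_one]
  | cons i l ih =>
    rw [List.nodup_cons] at hl
    have h1 := (commute_prod_site hl.1 Y (Z i)).eq
    have h2 := (commute_site_prod hl.1 (Y i) Z).eq
    have h3 := exchange_site (h i) i
    have h4 := ih hl.2
    simp only [List.map_cons, List.prod_cons, auxFst_mul, auxSnd_mul]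
    generalize (l.map fun i => site i (Y i)).prod = T at *
    generalize (l.map fun i => site i (Z i)).prod = T' at *
    generalize site i (Y i) = L at *
    generalize site i (Z i) = L' at *
    calc auxScalar _ X * (auxFst L * auxFst T) * (auxSnd L' * auxSnd T')
        = auxScalar _ X * auxFst L * (auxFst T * auxSnd L') * auxSnd T' := by
          simp only [mul_assoc]
      _ = auxScalar _ X * auxFst L * auxSnd L' * auxFst T * auxSnd T' := by
          rw [h1]; simp only [mul_assoc]
      _ = auxSnd L' * auxFst L * (auxScalar _ X * auxFst T * auxSnd T') := by
          rw [h3]; simp only [mul_assoc]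
      _ = auxSnd L' * (auxFst L * auxSnd T') * auxFst T * auxScalar _ X := by
          rw [h4]; simp only [mul_assoc]
      _ = _ := by rw [h2]; simp only [mul_assoc]

/-- The monodromy matrix `R₀N(x/z_N) ⋯ R₀₁(x/z₁)`. -/
noncomputable def monodromy (R : ℂ → Op2 n) (z : Fin N → ℂ) (x : ℂ) :
    Matrix (Fin n) (Fin n) (OpT (Fin N) n) :=
  ((List.finRange N).reverse.map fun i => site i (R (x / z i))).prod

lemma splitZero_row (R : ℂ → Op2 n) (z : Fin N → ℂ) (x : ℂ) :
    splitZero n N (row R z x) = monodromy R z x := by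
  rw [_root_.row, monodromy, map_list_prod, List.ofFn_eq_map, ← List.map_reverse, List.map_map]
  congr 2
  ext i : 1
  exact splitZero_legs_zero_succ i _

lemma legs_inv {i j : I} (h : i ≠ j) {X : Op2 n} (hX : IsUnit X) :
    (legs i j X⁻¹ : OpT I n) = (legs i j X)⁻¹ := by
  refine (inv_eq_left_inv ?_).symm
  rw [← legs_mul h, nonsing_inv_mul _ ((isUnit_iff_isUnit_det _).1 hX), legs_one]

/-- Inversion reverses the order of the sites, and 1/(x zᵢ) = (1/x)/zᵢ. -/
lemma invRow_eq {R : ℂ → Op2 n} {z : Fin N → ℂ} {x : ℂ}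
    (h : ∀ i, IsUnit (R (1 / (x * z i)))) : invRow R z x = (row R z (1 / x))⁻¹ := by
  rw [_root_.row, list_prod_inv_reverse, List.reverse_reverse, List.map_ofFn, invRow]
  congr 2
  ext i : 1
  rw [legs_inv (Fin.succ_ne_zero i).symm (h i), Function.comp_apply, div_div]

lemma isUnit_row {R : ℂ → Op2 n} {z : Fin N → ℂ} {x : ℂ}
    (h : ∀ i, IsUnit (R (1 / (x * z i)))) : IsUnit (row R z (1 / x)) := by
  refine List.prod_isUnit fun m hm => ?_
  rw [List.mem_reverse, List.mem_ofFn] at hm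
  obtain ⟨i, rfl⟩ := hm
  rw [div_div]
  exact isUnit_legs (Fin.succ_ne_zero i).symm (h i)

lemma splitZero_invRow_mul {R : ℂ → Op2 n} {z : Fin N → ℂ} {x : ℂ}
    (h : ∀ i, IsUnit (R (1 / (x * z i)))) :
    splitZero n N (invRow R z x) * monodromy R z (1 / x) = 1 := by
  rw [← splitZero_row, ← map_mul, invRow_eq h,
    nonsing_inv_mul _ ((isUnit_iff_isUnit_det _).1 (isUnit_row h)), map_one]

lemma mul_splitZero_invRow {R : ℂ → Op2 n} {z : Fin N → ℂ} {x : ℂ}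
    (h : ∀ i, IsUnit (R (1 / (x * z i)))) :
    monodromy R z (1 / x) * splitZero n N (invRow R z x) = 1 := by
  rw [← splitZero_row, ← map_mul, invRow_eq h,
    mul_nonsing_inv _ ((isUnit_iff_isUnit_det _).1 (isUnit_row h)), map_one]

/-- The inhomogeneity cancels in (x/zᵢ)/(y/zᵢ) = x/y, so the same intertwiner works at every site.
-/
lemma exchange_monodromy {R : ℂ → Op2 n} (hR : ∀ x y, y ≠ 0 → YBRel (R (x / y)) (R x) (R y))
    {z : Fin N → ℂ} (hz : ∀ i, z i ≠ 0) {x y : ℂ} (hy : y ≠ 0) :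
    auxScalar _ (R (x / y)) * auxFst (monodromy R z x) * auxSnd (monodromy R z y) =
      auxSnd (monodromy R z y) * auxFst (monodromy R z x) * auxScalar _ (R (x / y)) := by
  refine exchange_prod (fun i => ?_) (List.nodup_reverse.2 (List.nodup_finRange N))
  have := hR (x / z i) (y / z i) (div_ne_zero hy (hz i))
  rwa [div_div_div_cancel_right₀ (hz i)] at this

/-- The double-row monodromy matrix. -/
noncomputable def doubleRow (R : ℂ → Op2 n) (Km : ℂ → Op1 n) (z : Fin N → ℂ) (x : ℂ) :
    Matrix (Fin n) (Fin n) (OpT (Fin N) n) :=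
  splitZero n N (invRow R z x) * auxScalar _ (Km x) * monodromy R z x

lemma boundaryTransfer_eq (R : ℂ → Op2 n) (K' Km : ℂ → Op1 n) (z : Fin N → ℂ) (x : ℂ) :
    boundaryTransfer R K' Km z x = trace (auxScalar _ (K' x) * doubleRow R Km z x) := by
  rw [boundaryTransfer, trZero_eq_trace, doubleRow, ← splitZero_row]
  simp only [map_mul, splitZero_leg_zero, mul_assoc]

/-- Dressing a solution of the reflection equation. -/
lemma reflection_dressing {B : Type*} [Ring B] {a b ai bi a' b' ka kb r r' s s' : B}
    (ha : ai * a' = 1) (ha' : a' * ai = 1) (hb : bi * b' = 1) (hb' : b' * bi = 1)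
    (h1 : s * a * b' = b' * a * s) (h2 : r' * b' * a' = a' * b' * r')
    (h3 : r * a * b = b * a * r) (h4 : s' * b * a' = a' * b * s')
    (c1 : Commute a kb) (c2 : Commute ka b) (c3 : Commute ka bi) (c4 : Commute ai kb)
    (hK : r' * ka * s * kb = kb * s' * ka * r) :
    r' * (ai * ka * a) * s * (bi * kb * b) = bi * kb * b * s' * (ai * ka * a) * r := by
  -- `e1`, `e2` and `e4` are the exchange relations `h1`, `h2` and `h4` multiplied on both sides by
  -- inverse monodromies.
  have e1 : a * s * bi = bi * s * a := by
    calc a * s * bi = bi * (b' * a * s) * bi := by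
          rw [← mul_assoc, ← mul_assoc, hb, one_mul]
      _ = bi * s * a * (b' * bi) := by rw [← h1]; simp only [mul_assoc]
      _ = _ := by rw [hb', mul_one]
  have e2 : r' * ai * bi = bi * ai * r' := by
    calc r' * ai * bi = bi * (ai * a') * b' * r' * ai * bi := by
          rw [ha, mul_one, hb, one_mul]
      _ = bi * ai * (a' * b' * r') * ai * bi := by simp only [mul_assoc]
      _ = bi * ai * r' * (b' * (a' * ai) * bi) := by rw [← h2]; simp only [mul_assoc]
      _ = _ := by rw [ha', mul_one, hb', mul_one]
  have e4 : b * s' * ai = ai * s' * b := by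
    calc b * s' * ai = ai * (a' * b * s') * ai := by
          rw [← mul_assoc, ← mul_assoc, ha, one_mul]
      _ = ai * s' * b * (a' * ai) := by rw [← h4]; simp only [mul_assoc]
      _ = _ := by rw [ha', mul_one]
  calc r' * (ai * ka * a) * s * (bi * kb * b)
      = r' * ai * ka * (a * s * bi) * kb * b := by simp only [mul_assoc]
    _ = r' * ai * (ka * bi) * s * a * kb * b := by rw [e1]; simp only [mul_assoc]
    _ = (r' * ai * bi) * ka * s * (a * kb) * b := by rw [c3.eq]; simp only [mul_assoc]
    _ = bi * ai * (r' * ka * s * kb) * a * b := by rw [e2, c1.eq]; simp only [mul_assoc]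
    _ = bi * (ai * kb) * s' * ka * (r * a * b) := by rw [hK]; simp only [mul_assoc]
    _ = bi * kb * ai * s' * (ka * b) * a * r := by rw [h3, c4.eq]; simp only [mul_assoc]
    _ = bi * kb * (ai * s' * b) * ka * a * r := by rw [c2.eq]; simp only [mul_assoc]
    _ = _ := by rw [← e4]; simp only [mul_assoc]

/-- Dressing requires the exchange relation at the pairs (x, 1/y), (1/y, 1/x), (x, y) and (y, 1/x),
whose quotients are xy, x/y, x/y and xy. The second and fourth are used with the auxiliary spaces
flipped. -/
lemma reflection_doubleRow {R : ℂ → Op2 n}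
    (hR : ∀ x y, y ≠ 0 → YBRel (R (x / y)) (R x) (R y)) {Km : ℂ → Op1 n} {z : Fin N → ℂ}
    (hz : ∀ i, z i ≠ 0) {x y : ℂ} (hx : x ≠ 0) (hy : y ≠ 0)
    (hxz : ∀ i, IsUnit (R (1 / (x * z i)))) (hyz : ∀ i, IsUnit (R (1 / (y * z i))))
    (hK : swapLegs (R (x / y)) * fst (Km x) * R (x * y) * snd (Km y) =
      snd (Km y) * swapLegs (R (x * y)) * fst (Km x) * R (x / y)) :
    auxScalar _ (swapLegs (R (x / y))) * auxFst (doubleRow R Km z x) * auxScalar _ (R (x * y)) *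
        auxSnd (doubleRow R Km z y) =
      auxSnd (doubleRow R Km z y) * auxScalar _ (swapLegs (R (x * y))) *
        auxFst (doubleRow R Km z x) * auxScalar _ (R (x / y)) := by
  simp only [doubleRow, auxFst_mul, auxSnd_mul]
  refine reflection_dressing (a' := auxFst (monodromy R z (1 / x)))
    (b' := auxSnd (monodromy R z (1 / y))) ?_ ?_ ?_ ?_ ?_ ?_ ?_ ?_ ?_ ?_ ?_ ?_ ?_
  · rw [← auxFst_mul, splitZero_invRow_mul hxz, auxFst_one]
  · rw [← auxFst_mul, mul_splitZero_invRow hxz, auxFst_one]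
  · rw [← auxSnd_mul, splitZero_invRow_mul hyz, auxSnd_one]
  · rw [← auxSnd_mul, mul_splitZero_invRow hyz, auxSnd_one]
  · have := exchange_monodromy hR hz (x := x) (one_div_ne_zero hy)
    rwa [show x / (1 / y) = x * y by field_simp] at this
  · have := exchange_swap (exchange_monodromy hR hz (x := 1 / y) (one_div_ne_zero hx))
    rwa [show 1 / y / (1 / x) = x / y by field_simp] at this
  · exact exchange_monodromy hR hz hy
  · have := exchange_swap (exchange_monodromy hR hz (x := y) (one_div_ne_zero hx))
    rwa [show y / (1 / x) = x * y by field_simp] at this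
  · exact commute_auxFst_auxSnd_auxScalar _ _
  · exact commute_auxFst_auxScalar_auxSnd _ _
  · exact commute_auxFst_auxScalar_auxSnd _ _
  · exact commute_auxFst_auxSnd_auxScalar _ _
  · simp only [auxFst_auxScalar, auxSnd_auxScalar, ← map_mul, hK]

/-! ### Recovering K⁺ from K' and combining the relations. -/

lemma trFst_apply_eq_vecMul (K : Op1 n) (X : Op2 n) (b d : Fin n) :
    trFst (fst K * flipOp n * X) b d = ((fun p => K p.1 p.2) ᵥ* ptr1 X) (b, d) := by
  rw [trFst_apply_eq, vecMul, dotProduct, Fintype.sum_prod_type]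
  refine Finset.sum_congr rfl fun a _ => Finset.sum_congr rfl fun c _ => ?_
  have := flipOp_mul_apply (A := ℂ) X (c, b) (a, d)
  rw [auxScalar_id] at this
  rw [this]
  rfl

/-- On K written as a row vector, `phi` is right multiplication by a partial transpose. For `R` and
`tildeR R` these matrices are mutually inverse, so `phi R` undoes `phi (tildeR R)`. -/
lemma eq_trFst_of_eq_phi {R : ℂ → Op2 n} {K : ℂ → Op1 n} {Y : Op1 n} {x : ℂ}
    (hR : IsUnit (ptr1 (R (x ^ 2)))) (h : Y = phi (tildeR R) K x) :
    K x = trFst (fst Y * flipOp n * R (x ^ 2)) := by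
  ext b d
  have hY : (fun p : Fin n × Fin n => Y p.1 p.2) =
      (fun p : Fin n × Fin n => K x p.1 p.2) ᵥ* (ptr1 (R (x ^ 2)))⁻¹ := by
    ext ⟨a, c⟩
    rw [h]
    exact trFst_apply_eq_vecMul (K x) (tildeR R (x ^ 2)) a c
  rw [trFst_apply_eq_vecMul, hY, vecMul_vecMul,
    nonsing_inv_mul _ ((isUnit_iff_isUnit_det _).1 hR), vecMul_one]

/-- Commutativity of the boundary transfer matrices, at parameters where all operators are
invertible. -/
theorem boundaryTransfer_commute {R : ℂ → Op2 n}
    (hR : ∀ x y, y ≠ 0 → YBRel (R (x / y)) (R x) (R y)) {K' Kp Km : ℂ → Op1 n} {z : Fin N → ℂ}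
    (hz : ∀ i, z i ≠ 0) {x y : ℂ} (hx : x ≠ 0) (hy : y ≠ 0)
    (hxz : ∀ i, IsUnit (R (1 / (x * z i)))) (hyz : ∀ i, IsUnit (R (1 / (y * z i))))
    (hdiv : IsUnit (R (x / y))) (hxx : IsUnit (ptr1 (R (x ^ 2)))) (hyy : IsUnit (ptr1 (R (y ^ 2))))
    (hxy : IsUnit (ptr1 (R (x * y))))
    (hKx : K' x = phi (tildeR R) Kp x) (hKy : K' y = phi (tildeR R) Kp y)
    (hl : R (x / y) * fst (Kp x) * swapLegs (R (x * y)) * snd (Kp y) =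
      snd (Kp y) * R (x * y) * fst (Kp x) * swapLegs (R (x / y)))
    (hr : swapLegs (R (x / y)) * fst (Km x) * R (x * y) * snd (Km y) =
      snd (Km y) * swapLegs (R (x * y)) * fst (Km x) * R (x / y)) :
    Commute (boundaryTransfer R K' Km z x) (boundaryTransfer R K' Km z y) := by
  have hSt : ptr1 (tildeR R (x * y)) * ptr1 (R (x * y)) = 1 :=
    nonsing_inv_mul _ ((isUnit_iff_isUnit_det _).1 hxy)
  have hxy0 : x * y ≠ 0 := mul_ne_zero hx hy
  -- The four Yang–Baxter relations required by `dual_reflection`, with `Q`, `S`, `X`, `Y` equal to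
  -- R at x/y, xy, x², y².
  have h1 := hR (x ^ 2) (x * y) hxy0
  have h2 := hR (x * y) (y ^ 2) (pow_ne_zero 2 hy)
  have h3 := hR (x * y) (x / y) (div_ne_zero hx hy)
  have h4 := hR (x ^ 2) (x / y) (div_ne_zero hx hy)
  rw [show x ^ 2 / (x * y) = x / y by field_simp] at h1
  rw [show x * y / y ^ 2 = x / y by field_simp] at h2
  rw [show x * y / (x / y) = y ^ 2 by field_simp] at h3
  rw [show x ^ 2 / (x / y) = x * y by field_simp] at h4
  rw [eq_trFst_of_eq_phi hxx hKx, eq_trFst_of_eq_phi hyy hKy] at hl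
  rw [boundaryTransfer_eq, boundaryTransfer_eq]
  exact trace_commute_of_reflection hSt hdiv.swapLegs
    (dual_reflection h1 h2 h3 h4 hxy hxx hyy hSt hl)
    (reflection_doubleRow hR hz hx hy hxz hyz hr)

end Monodromy

/-! ### Generic properties -/

section Generic

variable {n N : ℕ}

lemma Generic.eventually_nhdsNE {p : ℂ → Prop} (h : Generic p) (a : ℂ) : ∀ᶠ x in 𝓝[≠] a, p x := by
  have := mem_codiscrete.1 h a
  rwa [disjoint_principal_right, compl_compl] at this

lemma generic_of_cofinite {p : ℂ → Prop} (h : ∀ᶠ x in cofinite, p x) : Generic p :=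
  codiscrete_le_cofinite h

lemma IsPolyOfDegree.continuous {ι : Type} {d : ℕ} {F : ℂ → Matrix ι ι ℂ}
    (h : IsPolyOfDegree d F) : Continuous F := by
  obtain ⟨A, hA⟩ := h
  rw [funext hA]
  exact continuous_finsetSum _ fun k _ => (continuous_pow k).smul continuous_const

lemma IsPolyOfDegree.ptr1 {d : ℕ} {F : ℂ → Op2 n} (h : IsPolyOfDegree d F) :
    IsPolyOfDegree d fun x => ptr1 (F x) := by
  obtain ⟨A, hA⟩ := h
  refine ⟨fun k => _root_.ptr1 (A k), fun x => ?_⟩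
  ext p q
  simp [ptr1_apply, hA, Matrix.sum_apply]

/-- The determinant is a polynomial and not zero, so it has finitely many roots. Finiteness matters:
an infinite closed discrete set could accumulate at 0 when pulled back along x ↦ 1/x. -/
lemma IsPolyOfDegree.eventually_cofinite_isUnit {ι : Type} [Fintype ι] [DecidableEq ι] {d : ℕ}
    {F : ℂ → Matrix ι ι ℂ} (h : IsPolyOfDegree d F) (hF : Generic fun x => IsUnit (F x)) :
    ∀ᶠ x in cofinite, IsUnit (F x) := by
  obtain ⟨A, hA⟩ := h
  let Q : Matrix ι ι (Polynomial ℂ) :=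
    of fun i j => ∑ k ∈ Finset.range (d + 1), Polynomial.C (A k i j) * Polynomial.X ^ k
  have hQ : ∀ x, (F x).det = Q.det.eval x := by
    intro x
    rw [← Polynomial.coe_evalRingHom, RingHom.map_det]
    congr 1
    ext i j
    rw [RingHom.mapMatrix_apply, map_apply, Polynomial.coe_evalRingHom, hA, Matrix.sum_apply]
    simp only [Q, of_apply, Polynomial.eval_finsetSum, Polynomial.eval_mul, Polynomial.eval_C,
      Polynomial.eval_pow, Polynomial.eval_X]
    exact Finset.sum_congr rfl fun k _ => mul_comm _ _
  have hQ0 : Q.det ≠ 0 := by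
    obtain ⟨x, hx⟩ := (hF.eventually_nhdsNE 0).exists
    intro h0
    rw [isUnit_iff_isUnit_det, hQ, h0] at hx
    simp at hx
  refine (Polynomial.finite_setOfPred_isRoot hQ0).subset fun x hx => ?_
  simpa [isUnit_iff_isUnit_det, hQ] using hx

lemma continuous_legs {I : Type} [Fintype I] [DecidableEq I] (i j : I) :
    Continuous (legs i j : Op2 n → OpT I n) := by
  refine continuous_matrix fun a b => ?_
  unfold legs
  split_ifs
  · exact continuous_id.matrix_elem _ _
  · exact continuous_const

lemma YBRel.of_tendsto {α : Type*} {l : Filter α} [l.NeBot] {f g h : α → Op2 n} {X Y Z : Op2 n}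
    (hf : Tendsto f l (𝓝 X)) (hg : Tendsto g l (𝓝 Y)) (hh : Tendsto h l (𝓝 Z))
    (H : ∀ᶠ a in l, YBRel (f a) (g a) (h a)) : YBRel X Y Z := by
  have h1 := ((continuous_legs (I := Fin 3) 0 1).tendsto X).comp hf
  have h2 := ((continuous_legs (I := Fin 3) 0 2).tendsto Y).comp hg
  have h3 := ((continuous_legs (I := Fin 3) 1 2).tendsto Z).comp hh
  exact tendsto_nhds_unique_of_eventuallyEq ((h1.mul h2).mul h3) ((h3.mul h2).mul h1) H

/-- By continuity, a continuous solution satisfies the Yang-Baxter equation everywhere. -/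
lemma YangBaxter.ybRel {R : ℂ → Op2 n} (hR : Continuous R) (h : YangBaxter R) (x y : ℂ)
    (hy : y ≠ 0) : YBRel (R (x / y)) (R x) (R y) := by
  -- The limit in y is taken first, for generic fixed x, and then the limit in x.
  have key : Generic fun x => ∀ y, y ≠ 0 → YBRel (R (x / y)) (R x) (R y) := by
    refine Filter.Eventually.mono h fun x hx y hy => ?_
    have ht : ContinuousAt (fun y => R (x / y)) y :=
      hR.continuousAt.comp (continuousAt_const.div continuousAt_id hy)
    exact YBRel.of_tendsto (ht.tendsto.mono_left nhdsWithin_le_nhds) tendsto_const_nhds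
      ((hR.tendsto y).mono_left nhdsWithin_le_nhds) (Generic.eventually_nhdsNE hx y)
  have ht : Continuous fun x => R (x / y) := hR.comp (continuous_id.div_const y)
  exact YBRel.of_tendsto ((ht.tendsto x).mono_left nhdsWithin_le_nhds)
    ((hR.tendsto x).mono_left nhdsWithin_le_nhds) tendsto_const_nhds
    ((key.eventually_nhdsNE x).mono fun x hx => hx y hy)

lemma tendsto_sq_cofinite : Tendsto (fun x : ℂ => x ^ 2) cofinite cofinite := by
  refine Tendsto.cofinite_of_finite_preimage_singleton fun c => ?_
  obtain ⟨s, rfl⟩ := IsAlgClosed.exists_pow_nat_eq c (n := 2) (by norm_num)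
  refine ((Set.finite_singleton (-s)).insert s).subset fun x hx => ?_
  simpa using sq_eq_sq_iff_eq_or_eq_neg.1 hx

/-- A family of matrices which commute generically commutes everywhere on its domain. -/
lemma merVal_commute {ι : Type} [Fintype ι] {F : ℂ → Matrix ι ι ℂ}
    (h : Generic₂ fun x y => F x * F y = F y * F x) {x y : ℂ} (hx : x ∈ merDom F)
    (hy : y ∈ merDom F) : merVal F x * merVal F y = merVal F y * merVal F x := by
  have hx' : Tendsto F (𝓝[≠] x) (𝓝 (merVal F x)) := tendsto_nhds_limUnder hx
  have hy' : Tendsto F (𝓝[≠] y) (𝓝 (merVal F y)) := tendsto_nhds_limUnder hy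
  -- For generic fixed `a` the second argument tends to `y`; the first argument follows afterwards.
  have h1 : Generic fun a => F a * merVal F y = merVal F y * F a :=
    Filter.Eventually.mono h fun a ha =>
      tendsto_nhds_unique_of_eventuallyEq (tendsto_const_nhds.mul hy') (hy'.mul tendsto_const_nhds)
        (Generic.eventually_nhdsNE ha y)
  exact tendsto_nhds_unique_of_eventuallyEq (hx'.mul tendsto_const_nhds)
    (tendsto_const_nhds.mul hx') (h1.eventually_nhdsNE x)

end Generic

/-! ### Meromorphy -/

section Mer

variable {n N : ℕ} {ι : Type}

lemma IsMer.mul [Fintype ι] {F G : ℂ → Matrix ι ι ℂ} (hF : IsMer F) (hG : IsMer G) :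
    IsMer fun x => F x * G x := fun i j x => by
  simp only [mul_apply]
  exact MeromorphicAt.fun_sum fun k _ => (hF i k x).mul (hG k j x)

lemma isMer_one [DecidableEq ι] : IsMer fun _ => (1 : Matrix ι ι ℂ) :=
  fun _ _ x => MeromorphicAt.const _ x

lemma isMer_list_prod [Fintype ι] [DecidableEq ι] {κ : Type} (l : List κ)
    {F : κ → ℂ → Matrix ι ι ℂ} (h : ∀ i, IsMer (F i)) :
    IsMer fun x => (l.map fun i => F i x).prod := by
  induction l with
  | nil => exact isMer_one
  | cons i l ih =>
    simp only [List.map_cons, List.prod_cons]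
    exact (h i).mul ih

lemma IsMer.meromorphicAt_det [Fintype ι] [DecidableEq ι] {F : ℂ → Matrix ι ι ℂ} (hF : IsMer F)
    (x : ℂ) : MeromorphicAt (fun x => (F x).det) x := by
  simp only [det_apply']
  exact MeromorphicAt.fun_sum fun σ _ =>
    (MeromorphicAt.const _ x).mul (MeromorphicAt.fun_prod fun i _ => hF _ _ x)

/-- Cramer's rule: the inverse determinant times the adjugate, whose entries are themselves
determinants of meromorphic matrices. -/
lemma IsMer.inv [Fintype ι] [DecidableEq ι] {F : ℂ → Matrix ι ι ℂ} (hF : IsMer F) :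
    IsMer fun x => (F x)⁻¹ := fun i j x => by
  simp only [inv_def, Matrix.smul_apply, Ring.inverse_eq_inv', smul_eq_mul, adjugate_apply]
  refine (hF.meromorphicAt_det x).inv.mul (IsMer.meromorphicAt_det (fun k l y => ?_) x)
  by_cases hk : k = j
  · subst hk
    simp only [updateRow_self]
    exact MeromorphicAt.const _ y
  · simp only [updateRow_ne hk]
    exact hF k l y

lemma IsPolyOfDegree.isMer_comp {d : ℕ} {F : ℂ → Matrix ι ι ℂ} (h : IsPolyOfDegree d F)
    {g : ℂ → ℂ} (hg : Meromorphic g) : IsMer fun x => F (g x) := fun i j x => by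
  obtain ⟨A, hA⟩ := h
  simp only [hA, Matrix.sum_apply, Matrix.smul_apply, smul_eq_mul]
  exact MeromorphicAt.fun_sum fun k _ => ((hg x).pow k).mul (MeromorphicAt.const _ x)

lemma IsMer.leg {I : Type} [Fintype I] [DecidableEq I] {F : ℂ → Op1 n} (hF : IsMer F) (i : I) :
    IsMer fun x => leg i (F x) := fun a b x => by
  simp only [_root_.leg]
  split_ifs
  · exact hF _ _ x
  · exact MeromorphicAt.const _ x

lemma IsMer.legs {I : Type} [Fintype I] [DecidableEq I] {F : ℂ → Op2 n} (hF : IsMer F) (i j : I) :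
    IsMer fun x => legs i j (F x) := fun a b x => by
  simp only [_root_.legs]
  split_ifs
  · exact hF _ _ x
  · exact MeromorphicAt.const _ x

lemma IsMer.trZero {F : ℂ → OpT (Fin (N + 1)) n} (hF : IsMer F) :
    IsMer fun x => trZero (F x) := fun b d x => by
  unfold _root_.trZero
  exact MeromorphicAt.fun_sum fun a _ => hF _ _ x

lemma isMer_boundaryTransfer {R : ℂ → Op2 n} {K' Km : ℂ → Op1 n} (z : Fin N → ℂ)
    (hR : IsPolyOfDegree 1 R) (hK' : IsPolyOfDegree 2 K') (hKm : IsPolyOfDegree 2 Km) :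
    IsMer (boundaryTransfer R K' Km z) := by
  have hid : Meromorphic fun x : ℂ => x := MeromorphicAt.id
  have hI : IsMer fun x => invRow R z x := by
    simp only [invRow, List.ofFn_eq_map]
    refine isMer_list_prod _ fun i => ((hR.isMer_comp fun x => ?_).inv.legs 0 i.succ)
    exact (MeromorphicAt.const _ x).div ((hid x).mul (MeromorphicAt.const _ x))
  have hT : IsMer fun x => row R z x := by
    simp only [_root_.row, List.ofFn_eq_map, ← List.map_reverse]
    refine isMer_list_prod _ fun i => ((hR.isMer_comp fun x => ?_).legs 0 i.succ)
    exact (hid x).div (MeromorphicAt.const _ x)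
  exact (((((hK'.isMer_comp hid).leg 0).mul hI).mul ((hKm.isMer_comp hid).leg 0)).mul hT).trZero

end Mer

/-! ### The main theorem: genericity and passage to the whole domain. -/

theorem mainTheorem4 {n N : ℕ}
    (R : ℂ → Op2 n) (K' Kp Km : ℂ → Op1 n) (M J : Op1 n) (r : ℂ) (z : Fin N → ℂ)
    (v : Module.Basis (Fin n) ℂ (Fin n → ℂ))
    (hM : IsUnit M) (hJ : IsUnit J) (hr : r ≠ 0) (hz : ∀ i, z i ≠ 0)
    -- the classes of functions
    (hR : IsMerUnit R) (hRt : IsMerUnit fun x => ptr1 (R x))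
    (hKp : IsMerUnit Kp) (hKm : IsMerUnit Km)
    -- `K' = φ_{R̃}(K⁺)`, as meromorphic functions
    (hK' : Generic fun x => K' x = phi (tildeR R) Kp x)
    -- polynomiality
    (hRpoly : IsPolyOfDegree 1 R) (hK'poly : IsPolyOfDegree 2 K') (hKmpoly : IsPolyOfDegree 2 Km)
    -- Yang-Baxter and reflection equations
    (hYBE : YangBaxter R) (hLRE : LeftReflection R Kp) (hRRE : RightReflection R Km)
    -- crossing symmetry, regularity, boundary regularity, boundary unitarity
    (hCS : CrossingSymmetry R M r)
    (hRreg : Prop1 (R 1) (flipOp n))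
    (hKmreg : Prop1 (Km 1) 1 ∧ Prop1 (Km (-1)) 1)
    (hRJ : Generic fun x => R x * (fst J * snd J) = (fst J * snd J) * swapLegs (R x))
    (hKpunit : BoundaryUnitary Kp) (hKmunit : BoundaryUnitary Km)
    (hK'M : Prop1 (K' r⁻¹) M ∧ Prop1 (K' (-r⁻¹)) M)
    -- conditions with respect to the ordered basis
    (hRim : RImageCondition v R) (hR0 : RZeroCondition v R)
    (hKmim : KImageCondition v Km) (hK'im : KImageCondition v K')
    (hK0 : KZeroCondition v K' Km) :
    IsMer (boundaryTransfer R K' Km z) ∧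
      ∀ x ∈ merDom (boundaryTransfer R K' Km z), ∀ y ∈ merDom (boundaryTransfer R K' Km z),
        merVal (boundaryTransfer R K' Km z) x * merVal (boundaryTransfer R K' Km z) y =
          merVal (boundaryTransfer R K' Km z) y * merVal (boundaryTransfer R K' Km z) x := by
  refine ⟨isMer_boundaryTransfer z hRpoly hK'poly hKmpoly,
    fun x hx y hy => merVal_commute ?_ hx hy⟩
  have hYB := hYBE.ybRel hRpoly.continuous
  have hu := hRpoly.eventually_cofinite_isUnit hR.2
  have hut := hRpoly.ptr1.eventually_cofinite_isUnit hRt.2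
  have hne : Generic fun x : ℂ => x ≠ 0 :=
    generic_of_cofinite (Set.finite_singleton (0 : ℂ)).eventually_cofinite_notMem
  have hsq : Generic fun x => IsUnit (ptr1 (R (x ^ 2))) :=
    generic_of_cofinite (tendsto_sq_cofinite.eventually hut)
  have hinv : Generic fun x => ∀ i, IsUnit (R (1 / (x * z i))) := by
    refine generic_of_cofinite (eventually_all.2 fun i => ?_)
    -- With the convention 1/0 = 0 this map is injective on all of ℂ, so it pulls cofinite sets back
    -- to cofinite sets.
    have : Function.Injective fun x => 1 / (x * z i) := fun x y h => by
      simpa [hz i] using h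
    exact this.tendsto_cofinite.eventually hu
  filter_upwards [hne, hsq, hinv, hK', hLRE, hRRE] with x hx hxx hxz hKx hl hr
  have hmul : Generic fun y => IsUnit (ptr1 (R (x * y))) :=
    generic_of_cofinite ((mul_right_injective₀ hx).tendsto_cofinite.eventually hut)
  have hdiv : Generic fun y => IsUnit (R (x / y)) := by
    -- Here too injectivity includes y = 0, since x/0 = 0 while `x` is nonzero.
    have : Function.Injective fun y => x / y := fun y y' h => by
      simpa [div_eq_mul_inv, hx] using h
    exact generic_of_cofinite (this.tendsto_cofinite.eventually hu)
  filter_upwards [hne, hsq, hinv, hK', hl, hr, hmul, hdiv] with y hy hyy hyz hKy hl hr hxy hdiv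
  exact (boundaryTransfer_commute hYB hz hx hy hxz hyz hdiv hxx hyy hxy hKx hKy hl hr).eq
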